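/- A commutative semiring $R$ is \emph{complete} if every family $(a_i)_{i\in I}$ of elements of $R$, indexed by an arbitrary set $I$, has a sum $\sum_{i\in I}a_i\in R$ such that these sums agree with the usual ones for finite $I$, satisfy $\sum_{i\in I}a_i=\sum_{j\in J}\sum_{i\in I_j}a_i$ for every partition $I=\bigsqcup_{j\in J}I_j$, and distribute over multiplication. For such $R$ let $R^\Pi$ be the category whose objects are sets, whose maps $X\to Y$ are functions (matrices) $f:X\times Y\to R$, with composition (in diagrammatic order) $(fg)(x,z)=\sum_{y\in Y}f(x,y)\,g(y,z)$ and identity the Kronecker function $\delta$. It is an additive symmetric monoidal category (enriched over commutative monoids) with entrywise sums of maps, tensor product $X\otimes Y=X\times Y$, $(f\otimes g)((x,x'),(y,y'))=f(x,y)\,g(x',y')$, and unit a singleton $\{*\}$. For a set $X$ let $!X$ be the set of finite bags (multisets) of elements of $X$, i.e. the free commutative monoid on $X$, and for $f:X\to Y$ in $R^\Pi$, $s\in\, !X$ and $t=[\![y_1,\dots,y_n]\!]\in\, !Y$ let $$(!f)(s,t)=\sum_{(x_1,\dots,x_n)}f(x_1,y_1)\cdots f(x_n,y_n),$$ the sum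 being over the distinct sequences $(x_1,\dots,x_n)$ with $[\![x_1,\dots,x_n]\!]=s$ (so it is $0$ if $s$ and $t$ have different sizes). Put \begin{align*} \rho_X(s,S)&=\delta\Big(s,\sum_{u\in S}u\Big), & \varepsilon_X(s,x)&=\delta(s,[\![x]\!]), & \Delta_X(s,(s_1,s_2))&=\delta(s,s_1+s_2), & \mathsf e_X(s,*)&=\delta(s,[\![\,]\!]),\\ \mathsf m_{X,Y}((s,t),r)&=\delta(s,\pi_1 r)\,\delta(t,\pi_2 r), & \mathsf m_{\{*\}}(*,s)&=1, & \mathsf d_X((s,x),t)&=t(x)\,\delta(s+[\![x]\!],t), && \end{align*} where $\pi_1r\in\,!X$ and $\pi_2r\in\,!Y$ are the bags of first and second components of $r\in\,!(X\times Y)$, and $t(x)\in\mathbb N$ is the multiplicity of $x$ in $t$. \textbf{Theorem.} Let $R$ be a complete commutative semiring in which every positive integer $n=1+\dots+1$ is invertible. Then $R^\Pi$ with the structure $(!,\rho,\varepsilon,\Delta,\mathsf e,\mathsf m,\mathsf m_{\{*\}},\mathsf d)$ is a differential linear category, that is, $(!,\rho,\varepsilon,\Delta,\mathsf e,\mathsf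 m,\mathsf m_{\{*\}})$ is a monoidal coalgebra modality and $\mathsf d$ is a deriving transformation (it is natural and satisfies the constant, Leibniz, linear, chain and interchange rules); and it has antiderivatives, that is, with $\mathsf d^\circ_X=\Delta_X(1_{!X}\otimes\varepsilon_X)$, the maps $$\mathsf K_X=\mathsf d^\circ_X\,\mathsf d_X+\,!(0):\ !X\to\, !X$$ form a natural isomorphism. Moreover, the two-element Boolean semiring $B=\{0,1\}$ (with $1+1=1$ and $\sum_i a_i=1$ if and only if some $a_i=1$) is a complete commutative semiring in which every positive integer is invertible, and the functor $B^\Pi\to\mathsf{REL}$ that is the identity on objects and sends $f:X\times Y\to B$ to the relation $\{(x,y): f(x,y)=1\}$ is an isomorphism of categories. -/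

import Mathlib

open CategoryTheory MonoidalCategory BigOperators

universe u v w w'

/-! ## Complete semirings -/

/-- A complete semiring: a semiring with sums of families indexed by arbitrary sets (here: types
in `Type u`), which extend the finite sums, may be computed blockwise along any partition
of the index set (given as the fibres of a map `p : I → J`), and over which
multiplication distributes on both sides. -/
class CompleteSemiring (R : Type v) [Semiring R] where
  /-- the sum of a family indexed by an arbitrary set -/
  csum : {I : Type u} → (I → R) → R
  csum_fintype : ∀ {I : Type u} [Fintype I] (a : I → R), csum a = ∑ i, a i
  csum_partition : ∀ {I J : Type u} (p : I → J) (a : I → R),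
    csum a = csum fun j : J => csum fun i : {i : I // p i = j} => a i
  mul_csum : ∀ {I : Type u} (r : R) (a : I → R), r * csum a = csum fun i => r * a i
  csum_mul : ∀ {I : Type u} (a : I → R) (r : R), csum a * r = csum fun i => a i * r

namespace CompleteSemiring

variable {R : Type v} [Semiring R] [CompleteSemiring.{u} R]

theorem csum_zero {I : Type u} : csum (fun _ : I => (0 : R)) = 0 := by
  have h := CompleteSemiring.csum_mul (fun _ : I => (0 : R)) 0
  simpa using h.symm

theorem csum_equiv {I J : Type u} (e : J ≃ I) (a : I → R) :
    csum a = csum fun j => a (e j) := by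
  rw [csum_partition e.symm a]
  congr 1
  funext j
  let _ : Unique {i : I // e.symm i = j} :=
    ⟨⟨⟨e j, by simp⟩⟩, fun i => Subtype.ext (by
      have := congrArg e i.2
      simpa using this)⟩
  rw [csum_fintype, Fintype.sum_unique]
  rfl

theorem csum_fst {I J : Type u} (a : I × J → R) :
    csum a = csum fun i => csum fun j => a (i, j) := by
  rw [csum_partition Prod.fst a]
  congr 1
  funext i
  exact csum_equiv (R := R) (I := {p : I × J // p.1 = i}) (J := J)
    ⟨fun j => ⟨(i, j), rfl⟩, fun p => p.1.2, fun _ => rfl, by rintro ⟨⟨_, j⟩, rfl⟩; rfl⟩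
    (fun p => a p.1)

theorem csum_comm {I J : Type u} (a : I → J → R) :
    (csum fun i => csum fun j => a i j) = csum fun j => csum fun i => a i j := by
  rw [← csum_fst (fun p : I × J => a p.1 p.2), ← csum_fst (fun p : J × I => a p.2 p.1)]
  exact csum_equiv (Equiv.prodComm J I) (fun p : I × J => a p.1 p.2)

theorem csum_add {I : Type u} (a b : I → R) :
    (csum fun i => a i + b i) = csum a + csum b := by
  have h := csum_comm (R := R) (I := I) (J := ULift.{u} Bool)
    (fun i t => if t.down then a i else b i)
  have e : ∀ F : ULift.{u} Bool → R, csum F = F ⟨true⟩ + F ⟨false⟩ := fun F => by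
    rw [csum_fintype, ← Equiv.ulift.symm.sum_comp F, Fintype.sum_bool]
    rfl
  simpa [e] using h

theorem csum_single {I : Type u} (i₀ : I) (a : I → R) (h : ∀ i, i ≠ i₀ → a i = 0) :
    csum a = a i₀ := by
  classical
  have key : ∀ j : Prop, (csum fun i : {i : I // (i = i₀) = j} => a i)
      = if j then a i₀ else 0 := by
    intro j
    by_cases hj : j
    · rw [if_pos hj]
      let _ : Unique {i : I // (i = i₀) = j} :=
        ⟨⟨⟨i₀, by simp [hj]⟩⟩, fun i => Subtype.ext (by
          have := i.2; simp only [hj, eq_iff_iff, iff_true] at this; exact this)⟩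
      rw [csum_fintype, Fintype.sum_unique]
      rfl
    · rw [if_neg hj, ← csum_zero (R := R) (I := {i : I // (i = i₀) = j})]
      congr 1
      funext i
      refine h i ?_
      have := i.2
      simp only [hj, eq_iff_iff, iff_false] at this
      exact this
  rw [csum_partition (fun i => (ULift.up.{u} (decide (i = i₀)))) a, csum_fintype,
    ← Equiv.ulift.symm.sum_comp, Fintype.sum_bool]
  have e1 : (csum fun i : {i : I // (ULift.up.{u} (decide (i = i₀))) = Equiv.ulift.symm true} => a i)
      = a i₀ := by
    have := key True
    rw [if_pos trivial] at this
    rw [← this]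
    exact csum_equiv (R := R) (Equiv.subtypeEquivRight (fun i => by
      simp [Equiv.ulift, ULift.ext_iff])) (fun i => a i.1)
  have e2 : (csum fun i : {i : I // (ULift.up.{u} (decide (i = i₀))) = Equiv.ulift.symm false} => a i)
      = 0 := by
    have := key False
    rw [if_neg not_false] at this
    rw [← this]
    exact csum_equiv (R := R) (Equiv.subtypeEquivRight (fun i => by
      simp [Equiv.ulift, ULift.ext_iff])) (fun i => a i.1)
  rw [e1, e2, add_zero]

end CompleteSemiring

open CompleteSemiring

/-! ## The category of sets and `R`-valued matrices -/

/-- The Kronecker function. -/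
noncomputable def kron (R : Type v) [Semiring R] {X : Type u} (x y : X) : R :=
  open Classical in if x = y then 1 else 0

/-- Objects of `R^Π`: sets. -/
structure RPi (R : Type v) : Type (u + 1) where
  /-- the underlying set -/
  carrier : Type u

namespace RPi

/-- Maps `X ⟶ Y` of `R^Π`: functions `X × Y → R`, in curried form. -/
@[ext]
structure Hom {R : Type v} (X Y : RPi.{u} R) : Type (max u v) where
  /-- the matrix of the map -/
  mat : X.carrier → Y.carrier → R

variable {R : Type v} [CommSemiring R] [CompleteSemiring.{u} R]

noncomputable instance : Category (RPi.{u} R) where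
  Hom X Y := Hom X Y
  id _ := ⟨kron R⟩
  comp f g := ⟨fun x z => csum fun y => f.mat x y * g.mat y z⟩
  id_comp f := by
    apply Hom.ext
    funext x y
    refine (csum_single x _ ?_).trans ?_
    · intro i hi
      simp [kron, hi.symm]
    · simp [kron]
  comp_id f := by
    apply Hom.ext
    funext x y
    refine (csum_single y _ ?_).trans ?_
    · intro i hi
      simp [kron, hi]
    · simp [kron]
  assoc f g h := by
    apply Hom.ext
    funext x y
    simp only [csum_mul, mul_csum, mul_assoc]
    exact csum_comm _

@[ext]
theorem hom_ext {X Y : RPi.{u} R} (f g : X ⟶ Y)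
    (h : ∀ x y, Hom.mat f x y = Hom.mat g x y) : f = g :=
  Hom.ext (funext fun x => funext fun y => h x y)

@[simp] theorem id_mat (X : RPi.{u} R) (x y) : Hom.mat (𝟙 X) x y = kron R x y := rfl

@[simp] theorem comp_mat {X Y Z : RPi.{u} R} (f : X ⟶ Y) (g : Y ⟶ Z) (x z) :
    Hom.mat (f ≫ g) x z = csum fun y => Hom.mat f x y * Hom.mat g y z := rfl

/-- The matrix of a function. -/
noncomputable def graph {X Y : RPi.{u} R} (h : X.carrier → Y.carrier) : X ⟶ Y :=
  Hom.mk fun x y => kron R (h x) y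

theorem graph_comp_mat {X Y Z : RPi.{u} R} (h : X.carrier → Y.carrier) (g : Y ⟶ Z) (x z) :
    Hom.mat (graph h ≫ g) x z = Hom.mat g (h x) z := by
  rw [comp_mat]
  refine (csum_single (h x) _ ?_).trans ?_
  · intro i hi
    simp [graph, kron, hi.symm]
  · simp [graph, kron]

theorem comp_graph_mat {X Y Z : RPi.{u} R} (f : X ⟶ Y) (e : Y.carrier ≃ Z.carrier) (x z) :
    Hom.mat (f ≫ graph e) x z = Hom.mat f x (e.symm z) := by
  rw [comp_mat]
  refine (csum_single (e.symm z) _ ?_).trans ?_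
  · intro i hi
    have : e i ≠ z := fun h => hi (by rw [← h]; simp)
    simp [graph, kron, this]
  · simp [graph, kron]

theorem graph_comp_graph {X Y Z : RPi.{u} R} (h : X.carrier → Y.carrier)
    (k : Y.carrier → Z.carrier) :
    (graph h : X ⟶ Y) ≫ (graph k : Y ⟶ Z) = graph (fun x => k (h x)) := by
  ext x z
  rw [graph_comp_mat]
  rfl

/-- A bijection, seen as an isomorphism of `R^Π`. -/
noncomputable def ofEquiv {X Y : RPi.{u} R} (e : X.carrier ≃ Y.carrier) : X ≅ Y where
  hom := graph e
  inv := graph e.symm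
  hom_inv_id := by rw [graph_comp_graph]; ext x y; simp [graph]
  inv_hom_id := by rw [graph_comp_graph]; ext x y; simp [graph]

noncomputable instance : MonoidalCategoryStruct (RPi.{u} R) where
  tensorObj X Y := ⟨X.carrier × Y.carrier⟩
  whiskerLeft _ _ _ f := Hom.mk fun p q => kron R p.1 q.1 * Hom.mat f p.2 q.2
  whiskerRight f _ := Hom.mk fun p q => Hom.mat f p.1 q.1 * kron R p.2 q.2
  tensorHom f g := Hom.mk fun p q => Hom.mat f p.1 q.1 * Hom.mat g p.2 q.2
  tensorUnit := ⟨PUnit⟩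
  associator X Y Z := ofEquiv (Equiv.prodAssoc X.carrier Y.carrier Z.carrier)
  leftUnitor X := ofEquiv (Equiv.punitProd X.carrier)
  rightUnitor X := ofEquiv (Equiv.prodPUnit X.carrier)

theorem kron_prod {R : Type v} [CommSemiring R] {X Y : Type u} (p q : X × Y) :
    kron R p q = kron R p.1 q.1 * kron R p.2 q.2 := by
  classical
  by_cases h1 : p.1 = q.1 <;> by_cases h2 : p.2 = q.2 <;> simp [kron, Prod.ext_iff, h1, h2]

theorem graph_whiskerRight {X Y Z : RPi.{u} R} (h : X.carrier → Y.carrier) :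
    (graph h : X ⟶ Y) ▷ Z = (graph fun p : X.carrier × Z.carrier => (h p.1, p.2)) := by
  apply Hom.ext
  funext p q
  exact (kron_prod (R := R) (h p.1, p.2) q).symm

theorem whiskerLeft_graph {X Y Z : RPi.{u} R} (h : X.carrier → Y.carrier) :
    Z ◁ (graph h : X ⟶ Y) = (graph fun p : Z.carrier × X.carrier => (p.1, h p.2)) := by
  apply Hom.ext
  funext p q
  exact (kron_prod (R := R) (p.1, h p.2) q).symm

noncomputable instance : MonoidalCategory (RPi.{u} R) :=
  MonoidalCategory.ofTensorHom
    (id_tensorHom_id := fun X Y => by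
      apply Hom.ext
      funext p q
      exact (kron_prod p q).symm)
    (id_tensorHom := fun _ _ _ _ => rfl)
    (tensorHom_id := fun _ _ => rfl)
    (tensorHom_comp_tensorHom := fun {X₁ Y₁ Z₁ X₂ Y₂ Z₂} f₁ f₂ g₁ g₂ => by
      apply Hom.ext
      funext p q
      refine (csum_fst (I := Y₁.carrier) (J := Y₂.carrier) _).trans ?_
      change _ = (csum fun y => Hom.mat f₁ p.1 y * Hom.mat g₁ y q.1) *
        (csum fun y => Hom.mat f₂ p.2 y * Hom.mat g₂ y q.2)
      rw [csum_mul]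
      congr 1
      funext y
      rw [mul_csum]
      congr 1
      funext y'
      exact mul_mul_mul_comm _ _ _ _)
    (associator_naturality := fun f₁ f₂ f₃ => by
      apply Hom.ext
      funext p q
      refine (comp_graph_mat _ _ p q).trans (Eq.trans ?_ (graph_comp_mat _ _ p q).symm)
      exact mul_assoc _ _ _)
    (leftUnitor_naturality := fun f => by
      apply Hom.ext
      funext p q
      refine (comp_graph_mat _ _ p q).trans (Eq.trans ?_ (graph_comp_mat _ _ p q).symm)
      change kron R PUnit.unit PUnit.unit * _ = _
      simp [kron]
      rfl)
    (rightUnitor_naturality := fun f => by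
      apply Hom.ext
      funext p q
      refine (comp_graph_mat _ _ p q).trans (Eq.trans ?_ (graph_comp_mat _ _ p q).symm)
      change _ * kron R PUnit.unit PUnit.unit = _
      simp [kron]
      rfl)
    (pentagon := fun W X Y Z => by
      change graph _ ▷ Z ≫ graph _ ≫ W ◁ graph _ = graph _ ≫ graph _
      rw [graph_whiskerRight, whiskerLeft_graph]
      erw [graph_comp_graph, graph_comp_graph, graph_comp_graph]
      rfl)
    (triangle := fun X Y => by
      change graph _ ≫ X ◁ graph _ = graph _ ▷ Y
      rw [graph_whiskerRight, whiskerLeft_graph]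
      erw [graph_comp_graph]
      rfl)

noncomputable instance : SymmetricCategory (RPi.{u} R) where
  braiding X Y := ofEquiv (Equiv.prodComm X.carrier Y.carrier)
  braiding_naturality_right X _ _ f := by
    apply Hom.ext
    funext p q
    refine (comp_graph_mat _ _ p q).trans (Eq.trans ?_ (graph_comp_mat _ _ p q).symm)
    exact mul_comm _ _
  braiding_naturality_left f Z := by
    apply Hom.ext
    funext p q
    refine (comp_graph_mat _ _ p q).trans (Eq.trans ?_ (graph_comp_mat _ _ p q).symm)
    exact mul_comm _ _
  hexagon_forward X Y Z := by
    change graph _ ≫ graph _ ≫ graph _ = graph _ ▷ Z ≫ graph _ ≫ Y ◁ graph _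
    rw [graph_whiskerRight, whiskerLeft_graph]
    erw [graph_comp_graph, graph_comp_graph, graph_comp_graph, graph_comp_graph]
    rfl
  hexagon_reverse X Y Z := by
    change graph _ ≫ graph _ ≫ graph _ = X ◁ graph _ ≫ graph _ ≫ graph _ ▷ Y
    rw [graph_whiskerRight, whiskerLeft_graph]
    erw [graph_comp_graph, graph_comp_graph, graph_comp_graph, graph_comp_graph]
    rfl
  symmetry X Y := (ofEquiv (Equiv.prodComm X.carrier Y.carrier)).hom_inv_id

end RPi

/-! ## Differential linear categories with antiderivatives -/

/-- An additive category in the sense of differential categories: a category enriched in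
commutative monoids (neither negatives nor biproducts are required). -/
class AdditiveCat (C : Type w) [Category.{w'} C] where
  homAddCommMonoid : ∀ X Y : C, AddCommMonoid (X ⟶ Y)
  add_comp : ∀ {X Y Z : C} (f g : X ⟶ Y) (h : Y ⟶ Z), (f + g) ≫ h = f ≫ h + g ≫ h
  comp_add : ∀ {X Y Z : C} (f : X ⟶ Y) (g h : Y ⟶ Z), f ≫ (g + h) = f ≫ g + f ≫ h
  zero_comp : ∀ {X Y Z : C} (h : Y ⟶ Z), (0 : X ⟶ Y) ≫ h = 0
  comp_zero : ∀ {X Y Z : C} (f : X ⟶ Y), f ≫ (0 : Y ⟶ Z) = 0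

attribute [reducible, instance] AdditiveCat.homAddCommMonoid

/-- An additive symmetric monoidal category: the tensor product of maps preserves sums and
zero in each argument. -/
class AdditiveSymmMonoidal (C : Type w) [Category.{w'} C] [MonoidalCategory C]
    [SymmetricCategory C] extends AdditiveCat C where
  tensor_add : ∀ {A B X Y : C} (k : A ⟶ B) (f g : X ⟶ Y), k ⊗ₘ (f + g) = k ⊗ₘ f + k ⊗ₘ g
  add_tensor : ∀ {A B X Y : C} (f g : X ⟶ Y) (k : A ⟶ B), (f + g) ⊗ₘ k = f ⊗ₘ k + g ⊗ₘ k
  tensor_zero : ∀ {A B X Y : C} (k : A ⟶ B), k ⊗ₘ (0 : X ⟶ Y) = 0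
  zero_tensor : ∀ {A B X Y : C} (k : A ⟶ B), (0 : X ⟶ Y) ⊗ₘ k = 0

/-- The data `(!, ρ, ε, Δ, e, m, m_I, d)` of a differential linear category; the laws are
the predicates below. -/
structure ExponentialData (C : Type w) [Category.{w'} C] [MonoidalCategory C] where
  /-- `!` on objects -/
  bang : C → C
  /-- `!` on maps -/
  bangMap : ∀ {A B : C}, (A ⟶ B) → (bang A ⟶ bang B)
  /-- comultiplication of the comonad -/
  rho : ∀ A : C, bang A ⟶ bang (bang A)
  /-- counit of the comonad -/
  eps : ∀ A : C, bang A ⟶ A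
  /-- comultiplication of the comonoid `!A` -/
  Delta : ∀ A : C, bang A ⟶ bang A ⊗ bang A
  /-- counit of the comonoid `!A` -/
  e : ∀ A : C, bang A ⟶ 𝟙_ C
  /-- the binary part of the monoidal structure of `!` -/
  m : ∀ A B : C, bang A ⊗ bang B ⟶ bang (A ⊗ B)
  /-- the nullary part of the monoidal structure of `!` -/
  mI : 𝟙_ C ⟶ bang (𝟙_ C)
  /-- the deriving transformation -/
  d : ∀ A : C, bang A ⊗ A ⟶ bang A

namespace ExponentialData

variable {C : Type w} [Category.{w'} C] [MonoidalCategory C]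

/-- `(!, ρ, ε, Δ, e)` is a coalgebra modality. -/
structure IsCoalgebraModality [SymmetricCategory C] (E : ExponentialData C) : Prop where
  map_id : ∀ A : C, E.bangMap (𝟙 A) = 𝟙 (E.bang A)
  map_comp : ∀ {X Y Z : C} (f : X ⟶ Y) (g : Y ⟶ Z),
    E.bangMap (f ≫ g) = E.bangMap f ≫ E.bangMap g
  rho_natural : ∀ {X Y : C} (f : X ⟶ Y),
    E.bangMap f ≫ E.rho Y = E.rho X ≫ E.bangMap (E.bangMap f)
  eps_natural : ∀ {X Y : C} (f : X ⟶ Y), E.bangMap f ≫ E.eps Y = E.eps X ≫ f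
  Delta_natural : ∀ {X Y : C} (f : X ⟶ Y),
    E.bangMap f ≫ E.Delta Y = E.Delta X ≫ (E.bangMap f ⊗ₘ E.bangMap f)
  e_natural : ∀ {X Y : C} (f : X ⟶ Y), E.bangMap f ≫ E.e Y = E.e X
  rho_eps : ∀ A : C, E.rho A ≫ E.eps (E.bang A) = 𝟙 (E.bang A)
  rho_map_eps : ∀ A : C, E.rho A ≫ E.bangMap (E.eps A) = 𝟙 (E.bang A)
  rho_rho : ∀ A : C, E.rho A ≫ E.rho (E.bang A) = E.rho A ≫ E.bangMap (E.rho A)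
  Delta_assoc : ∀ A : C,
    E.Delta A ≫ (E.Delta A ▷ E.bang A) ≫ (α_ (E.bang A) (E.bang A) (E.bang A)).hom =
      E.Delta A ≫ (E.bang A ◁ E.Delta A)
  Delta_e_left : ∀ A : C, E.Delta A ≫ (E.e A ▷ E.bang A) = (λ_ (E.bang A)).inv
  Delta_e_right : ∀ A : C, E.Delta A ≫ (E.bang A ◁ E.e A) = (ρ_ (E.bang A)).inv
  Delta_comm : ∀ A : C, E.Delta A ≫ (β_ (E.bang A) (E.bang A)).hom = E.Delta A
  rho_Delta : ∀ A : C, E.Delta A ≫ (E.rho A ⊗ₘ E.rho A) = E.rho A ≫ E.Delta (E.bang A)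
  rho_e : ∀ A : C, E.rho A ≫ E.e (E.bang A) = E.e A

/-- The laws which, in addition to those of a coalgebra modality, make
`(!, ρ, ε, Δ, e, m, m_I)` a monoidal coalgebra modality. -/
structure IsMonoidalModality [SymmetricCategory C] (E : ExponentialData C) : Prop where
  m_natural : ∀ {A B X Y : C} (f : A ⟶ B) (g : X ⟶ Y),
    (E.bangMap f ⊗ₘ E.bangMap g) ≫ E.m B Y = E.m A X ≫ E.bangMap (f ⊗ₘ g)
  m_assoc : ∀ X Y Z : C,
    (E.m X Y ▷ E.bang Z) ≫ E.m (X ⊗ Y) Z ≫ E.bangMap (α_ X Y Z).hom =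
      (α_ (E.bang X) (E.bang Y) (E.bang Z)).hom ≫ (E.bang X ◁ E.m Y Z) ≫ E.m X (Y ⊗ Z)
  m_unit_left : ∀ A : C,
    (E.mI ▷ E.bang A) ≫ E.m (𝟙_ C) A ≫ E.bangMap (λ_ A).hom = (λ_ (E.bang A)).hom
  m_unit_right : ∀ A : C,
    (E.bang A ◁ E.mI) ≫ E.m A (𝟙_ C) ≫ E.bangMap (ρ_ A).hom = (ρ_ (E.bang A)).hom
  m_symm : ∀ A B : C,
    (β_ (E.bang A) (E.bang B)).hom ≫ E.m B A = E.m A B ≫ E.bangMap (β_ A B).hom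
  m_rho : ∀ A B : C,
    E.m A B ≫ E.rho (A ⊗ B) =
      (E.rho A ⊗ₘ E.rho B) ≫ E.m (E.bang A) (E.bang B) ≫ E.bangMap (E.m A B)
  m_eps : ∀ A B : C, E.m A B ≫ E.eps (A ⊗ B) = E.eps A ⊗ₘ E.eps B
  mI_rho : E.mI ≫ E.rho (𝟙_ C) = E.mI ≫ E.bangMap E.mI
  mI_eps : E.mI ≫ E.eps (𝟙_ C) = 𝟙 (𝟙_ C)
  m_Delta : ∀ A B : C,
    E.m A B ≫ E.Delta (A ⊗ B) =
      (E.Delta A ⊗ₘ E.Delta B) ≫ tensorμ (E.bang A) (E.bang A) (E.bang B) (E.bang B) ≫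
        (E.m A B ⊗ₘ E.m A B)
  m_e : ∀ A B : C, E.m A B ≫ E.e (A ⊗ B) = (E.e A ⊗ₘ E.e B) ≫ (λ_ (𝟙_ C)).hom
  mI_Delta : E.mI ≫ E.Delta (𝟙_ C) = (λ_ (𝟙_ C)).inv ≫ (E.mI ⊗ₘ E.mI)
  mI_e : E.mI ≫ E.e (𝟙_ C) = 𝟙 (𝟙_ C)
  rho_map_Delta : ∀ A : C,
    E.rho A ≫ E.bangMap (E.Delta A) =
      E.Delta A ≫ (E.rho A ⊗ₘ E.rho A) ≫ E.m (E.bang A) (E.bang A)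
  rho_map_e : ∀ A : C, E.rho A ≫ E.bangMap (E.e A) = E.e A ≫ E.mI

/-- `d` is a deriving transformation. -/
structure IsDeriving [SymmetricCategory C] [AdditiveSymmMonoidal C] (E : ExponentialData C) :
    Prop where
  d_natural : ∀ {X Y : C} (f : X ⟶ Y), (E.bangMap f ⊗ₘ f) ≫ E.d Y = E.d X ≫ E.bangMap f
  constant_rule : ∀ A : C, E.d A ≫ E.e A = 0
  leibniz_rule : ∀ A : C,
    E.d A ≫ E.Delta A =
      (E.Delta A ▷ A) ≫ (α_ (E.bang A) (E.bang A) A).hom ≫ (E.bang A ◁ (β_ (E.bang A) A).hom) ≫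
          (α_ (E.bang A) A (E.bang A)).inv ≫ (E.d A ▷ E.bang A) +
        (E.Delta A ▷ A) ≫ (α_ (E.bang A) (E.bang A) A).hom ≫ (E.bang A ◁ E.d A)
  linear_rule : ∀ A : C, E.d A ≫ E.eps A = (E.e A ▷ A) ≫ (λ_ A).hom
  chain_rule : ∀ A : C,
    E.d A ≫ E.rho A =
      (E.Delta A ▷ A) ≫ (α_ (E.bang A) (E.bang A) A).hom ≫ (E.rho A ⊗ₘ E.d A) ≫ E.d (E.bang A)
  interchange_rule : ∀ A : C,
    (E.d A ▷ A) ≫ E.d A =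
      (α_ (E.bang A) A A).hom ≫ (E.bang A ◁ (β_ A A).hom) ≫ (α_ (E.bang A) A A).inv ≫
        (E.d A ▷ A) ≫ E.d A

/-- The additive symmetric monoidal category `C` with the data `E` is a differential linear
category: a differential category whose coalgebra modality is monoidal. -/
structure IsDifferentialLinear [SymmetricCategory C] [AdditiveSymmMonoidal C]
    (E : ExponentialData C) : Prop where
  coalgebraModality : E.IsCoalgebraModality
  monoidalModality : E.IsMonoidalModality
  deriving_transformation : E.IsDeriving

/-- The coderiving transformation `!A ⟶ !A ⊗ A`. -/
def coderiving (E : ExponentialData C) (A : C) : E.bang A ⟶ E.bang A ⊗ A :=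
  E.Delta A ≫ (E.bang A ◁ E.eps A)

/-- The transformation `K_A = d°_A d_A + !(0)`. -/
def K [AdditiveCat C] (E : ExponentialData C) (A : C) : E.bang A ⟶ E.bang A :=
  E.coderiving A ≫ E.d A + E.bangMap (0 : A ⟶ A)

/-- `K` is a natural isomorphism. -/
structure HasAntiderivatives [AdditiveCat C] (E : ExponentialData C) : Prop where
  K_natural : ∀ {X Y : C} (f : X ⟶ Y), E.bangMap f ≫ E.K Y = E.K X ≫ E.bangMap f
  K_isIso : ∀ A : C, IsIso (E.K A)

end ExponentialData

/-! ## The additive structure and the finite-bag exponential on `R^Π` -/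

namespace RPi

variable {R : Type v} [CommSemiring R] [CompleteSemiring.{u} R]

/-- Sums of maps are computed entrywise. -/
instance (X Y : RPi.{u} R) : Add (X ⟶ Y) where
  add f g := Hom.mk fun x y => Hom.mat f x y + Hom.mat g x y

instance (X Y : RPi.{u} R) : Zero (X ⟶ Y) where
  zero := Hom.mk fun _ _ => 0

instance (X Y : RPi.{u} R) : AddCommMonoid (X ⟶ Y) where
  add_assoc _ _ _ := Hom.ext (funext fun _ => funext fun _ => add_assoc _ _ _)
  zero_add _ := Hom.ext (funext fun _ => funext fun _ => zero_add _)
  add_zero _ := Hom.ext (funext fun _ => funext fun _ => add_zero _)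
  add_comm _ _ := Hom.ext (funext fun _ => funext fun _ => add_comm _ _)
  nsmul := nsmulRec

@[simp] theorem add_mat {X Y : RPi.{u} R} (f g : X ⟶ Y) (x y) :
    Hom.mat (f + g) x y = Hom.mat f x y + Hom.mat g x y := rfl

@[simp] theorem zero_mat {X Y : RPi.{u} R} (x y) : Hom.mat (0 : X ⟶ Y) x y = 0 := rfl

noncomputable instance : AdditiveSymmMonoidal (RPi.{u} R) where
  homAddCommMonoid X Y := inferInstance
  add_comp f g h := by ext x z; simp [add_mul, csum_add]
  comp_add f g h := by ext x z; simp [mul_add, csum_add]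
  zero_comp h := by ext x z; simp [csum_zero]
  comp_zero f := by ext x z; simp [csum_zero]
  tensor_add k f g := Hom.ext (funext fun _ => funext fun _ => mul_add _ _ _)
  add_tensor f g k := Hom.ext (funext fun _ => funext fun _ => add_mul _ _ _)
  tensor_zero k := Hom.ext (funext fun _ => funext fun _ => mul_zero _)
  zero_tensor k := Hom.ext (funext fun _ => funext fun _ => zero_mul _)

/-- The matrix of `!f`: for bags `s` and `t = ⟦y₁, …, yₙ⟧`, the entry at `(s, t)` is the sum, over
the distinct orderings `(x₁, …, xₙ)` of the bag `s`, of `f(x₁, y₁) ⋯ f(xₙ, yₙ)`; it is zero if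
the bags have different sizes. (It does not depend on the chosen ordering of `t`.) -/
noncomputable def bagMatrix {X Y : Type u} (f : X → Y → R) (s : Multiset X) (t : Multiset Y) : R :=
  open Classical in
  if s.card = t.card then ∑ l ∈ s.lists.toFinset, (List.zipWith f l t.toList).prod else 0

variable (R) in
/-- The finite-bag exponential on `R^Π`: `!X` is the free commutative monoid on `X`, the
set of finite bags of elements of `X`. -/
noncomputable def bagExponential : ExponentialData (RPi.{u} R) where
  bang X := ⟨Multiset X.carrier⟩
  bangMap f := Hom.mk (bagMatrix (Hom.mat f))
  rho _ := Hom.mk fun s S => kron R s S.join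
  eps _ := Hom.mk fun s x => kron R s {x}
  Delta _ := Hom.mk fun s p => kron R s (p.1 + p.2)
  e _ := Hom.mk fun s _ => kron R s 0
  m _ _ := Hom.mk fun p t => kron R p.1 (t.map Prod.fst) * kron R p.2 (t.map Prod.snd)
  mI := Hom.mk fun _ _ => 1
  d _ := Hom.mk fun p t => (open Classical in (t.count p.2 : R)) * kron R (p.2 ::ₘ p.1) t

end RPi

/-! ## The relational model -/

/-- The two-element Boolean semiring `{0, 1}`, with `1 + 1 = 1`. -/
def BoolSemiring : Type := Bool

namespace BoolSemiring

instance : Add BoolSemiring := ⟨or⟩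

instance : Mul BoolSemiring := ⟨and⟩

instance : Zero BoolSemiring := ⟨false⟩

instance : One BoolSemiring := ⟨true⟩

instance : CommSemiring BoolSemiring where
  add_assoc := Bool.or_assoc
  zero_add := Bool.false_or
  add_zero := Bool.or_false
  add_comm := Bool.or_comm
  nsmul := nsmulRec
  mul_assoc := Bool.and_assoc
  one_mul := Bool.true_and
  mul_one := Bool.and_true
  mul_comm := Bool.and_comm
  zero_mul := Bool.false_and
  mul_zero := Bool.and_false
  left_distrib := Bool.and_or_distrib_left
  right_distrib := Bool.and_or_distrib_right

theorem eq_zero_or_one (a : BoolSemiring) : a = 0 ∨ a = 1 :=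
  match a with
  | false => Or.inl rfl
  | true => Or.inr rfl

theorem one_ne_zero' : (1 : BoolSemiring) ≠ 0 := Bool.noConfusion

theorem eq_iff {a b : BoolSemiring} : a = b ↔ (a = 1 ↔ b = 1) := by
  rcases eq_zero_or_one a with rfl | rfl <;> rcases eq_zero_or_one b with rfl | rfl <;>
    simp [one_ne_zero', one_ne_zero'.symm]

theorem mul_eq_one {a b : BoolSemiring} : a * b = 1 ↔ a = 1 ∧ b = 1 := by
  rcases eq_zero_or_one a with rfl | rfl <;> rcases eq_zero_or_one b with rfl | rfl <;>
    simp [one_ne_zero'.symm]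

theorem add_eq_one {a b : BoolSemiring} : a + b = 1 ↔ a = 1 ∨ b = 1 := by
  have h : (1 + 1 : BoolSemiring) = 1 := rfl
  rcases eq_zero_or_one a with rfl | rfl <;> rcases eq_zero_or_one b with rfl | rfl <;>
    simp [h]

theorem sum_eq_one {I : Type u} (s : Finset I) (a : I → BoolSemiring) :
    ∑ i ∈ s, a i = 1 ↔ ∃ i ∈ s, a i = 1 := by
  classical
  induction s using Finset.induction_on with
  | empty => simp [one_ne_zero'.symm]
  | insert i s hi ih => simp [Finset.sum_insert hi, add_eq_one, ih]

/-- The sum of a family is `1` if some member is `1`, and `0` otherwise. -/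
noncomputable def boolSum {I : Type u} (a : I → BoolSemiring) : BoolSemiring :=
  open Classical in if ∃ i, a i = 1 then 1 else 0

theorem boolSum_eq_one {I : Type u} (a : I → BoolSemiring) : boolSum a = 1 ↔ ∃ i, a i = 1 := by
  unfold boolSum
  split_ifs with h <;> simp [h]

noncomputable instance : CompleteSemiring.{u} BoolSemiring where
  csum := boolSum
  csum_fintype a := by rw [eq_iff, boolSum_eq_one, sum_eq_one]; simp
  csum_partition p a := by
    rw [eq_iff, boolSum_eq_one, boolSum_eq_one]
    simp only [boolSum_eq_one]
    exact ⟨fun ⟨i, hi⟩ => ⟨p i, ⟨i, rfl⟩, hi⟩, fun ⟨_, i, hi⟩ => ⟨i.1, hi⟩⟩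
  mul_csum r a := by
    rw [eq_iff, mul_eq_one, boolSum_eq_one, boolSum_eq_one]
    simp only [mul_eq_one, exists_and_left]
  csum_mul a r := by
    rw [eq_iff, mul_eq_one, boolSum_eq_one, boolSum_eq_one]
    simp only [mul_eq_one, exists_and_right]

/-- The functor from `B^Π`, for `B` the Boolean semiring, to the category of sets and
relations, which keeps the set and sends a matrix `f` to the relation `{(x, y) | f(x, y) = 1}`. -/
def toRel : RPi.{u} BoolSemiring ⥤ RelCat.{u} where
  obj X := X.carrier
  map {_ _} f := RelCat.Hom.ofRel {p | RPi.Hom.mat f p.1 p.2 = 1}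
  map_id X := by
    apply RelCat.Hom.ext
    ext ⟨x, y⟩
    by_cases h : x = y
    · subst h
      simp only [Set.mem_ofPred_eq, RPi.id_mat, kron, if_true]
      exact ⟨fun _ => rfl, fun _ => trivial⟩
    · have : (kron BoolSemiring x y) = 0 := by simp [kron, h]
      simp only [Set.mem_ofPred_eq, RPi.id_mat, this]
      exact ⟨fun h' => absurd h'.symm one_ne_zero', fun h' => absurd h' h⟩
  map_comp f g := by
    apply RelCat.Hom.ext
    ext ⟨x, z⟩
    change boolSum _ = 1 ↔ _
    rw [boolSum_eq_one]
    simp only [mul_eq_one]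
    rfl

end BoolSemiring

/-!
For a function `h : Y → X` let `cograph h : X ⟶ Y` be the transpose of its matrix. All structure
maps of the exponential other than `!f` and `d`, and all structural isomorphisms of the monoidal
category, are transposed graphs; transposed graphs compose and tensor like functions, and
`!(cograph h) = cograph (map h)` (`RPi.bangMap_cograph`). So every law that mentions neither `d`
nor an arbitrary matrix `f` is an identity between functions on bags.

The naturality laws rest on the fact that `!Y` is the cofree cocommutative comonoid on `Y`, of which
only uniqueness is needed: a comonoid morphism into `!Y` is determined by its composite with `ε`
(`RPi.IsComult.ext_eps`). A transposed graph of a monoid homomorphism is a comonoid morphism. That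
`!f` is one as well follows from `RPi.bagMatrix_eq_prod`: in the semiring of functions on bags under
convolution, the column of `!f` at a bag `t` is the product of the columns of `f` at the elements of
`t`. This also shows that the matrix of `!f` does not depend on the ordering chosen for `t`.

Precomposition with `d` is the derivative `(∂ₓ a)(s) = (s(x) + 1) a(s + x)` on the convolution
semiring. It is a derivation (`RPi.deriv_mul`), and the derivative of a product of columns is the
naturality of `d` (`RPi.count_mul_bagMatrix_cons`). The Leibniz and chain rules both come from
counting the ways to remove `x` from one summand of a bag (`RPi.sum_kron_erase`).

Finally `K` is diagonal, with entry `max(n, 1)` at a bag of size `n` (`RPi.K_eq_diag`): it is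
invertible because the positive integers are, and natural because `!f` preserves the size of bags.
-/

/-! ### Sums over arbitrary index sets -/

section kron

variable {R : Type v} [Semiring R] {X : Type u}

theorem kron_comm (x y : X) : kron R x y = kron R y x := by
  by_cases h : x = y
  · rw [h]
  · simp [kron, h, Ne.symm h]

theorem kron_self (x : X) : kron R x x = 1 := by
  simp [kron]

theorem kron_of_ne {x y : X} (h : x ≠ y) : kron R x y = 0 := by
  simp [kron, h]

theorem kron_of_injective {Y : Type u} {h : X → Y} (hh : Function.Injective h) (x y : X) :
    kron R (h x) (h y) = kron R x y := by
  by_cases e : x = y <;> simp [kron, hh.eq_iff, e]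

/-- A factor next to a Kronecker function may be rewritten along the equality it imposes. -/
theorem kron_mul_congr {x y : X} {r r' : R} (h : x = y → r = r') :
    kron R x y * r = kron R x y * r' := by
  by_cases e : x = y
  · rw [h e]
  · rw [kron_of_ne e, zero_mul, zero_mul]

end kron

namespace CompleteSemiring

variable {R : Type v} [CommSemiring R] [CompleteSemiring.{u} R]

theorem csum_kron_left {X : Type u} (a : X) (F : X → R) :
    (csum fun x => kron R a x * F x) = F a := by
  rw [csum_single a _ fun i hi => by rw [kron_of_ne hi.symm, zero_mul], kron_self, one_mul]

theorem csum_kron_right {X : Type u} (a : X) (F : X → R) :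
    (csum fun x => kron R x a * F x) = F a := by
  simpa only [kron_comm] using csum_kron_left a F

/-- A family which vanishes outside the range of an injective map may be summed along that map. -/
theorem csum_of_injective {I J : Type u} (g : J → I) (hg : Function.Injective g) (a : I → R)
    (ha : ∀ i, i ∉ Set.range g → a i = 0) : csum a = csum fun j => a (g j) := by
  -- Write `a` as a double sum of point masses and exchange the two summations.
  have key : a = fun i => csum fun j => kron R i (g j) * a (g j) := by
    funext i
    by_cases hi : i ∈ Set.range g
    · obtain ⟨j, rfl⟩ := hi
      rw [csum_single j _ fun k hk => by rw [kron_of_ne fun h => hk (hg h).symm, zero_mul],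
        kron_self, one_mul]
    · rw [ha i hi, ← csum_zero (R := R) (I := J)]
      congr 1
      funext j
      rw [kron_of_ne fun h => hi ⟨j, h.symm⟩, zero_mul]
  conv_lhs => rw [key]
  rw [csum_comm]
  congr 1
  funext j
  exact csum_kron_right (g j) fun _ => a (g j)

theorem csum_finset_sum {I : Type u} {ι : Type*} (S : Finset ι) (a : ι → I → R) :
    (csum fun i => ∑ k ∈ S, a k i) = ∑ k ∈ S, csum (a k) := by
  classical
  induction S using Finset.induction_on with
  | empty => simp [csum_zero]
  | insert k S hk ih => simp only [Finset.sum_insert hk, csum_add, ih]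

/-- A family of finite support has its finite sum. -/
theorem csum_eq_sum {I : Type u} (S : Finset I) (a : I → R) (h : ∀ i, i ∉ S → a i = 0) :
    csum a = ∑ i ∈ S, a i := by
  classical
  have key : a = fun i => ∑ k ∈ S, kron R i k * a k := by
    funext i
    by_cases hi : i ∈ S
    · rw [Finset.sum_eq_single_of_mem i hi fun k _ hk => by rw [kron_of_ne hk.symm, zero_mul],
        kron_self, one_mul]
    · rw [h i hi, Finset.sum_eq_zero fun k hk => by
        rw [kron_of_ne (show i ≠ k from fun e => hi (e ▸ hk)), zero_mul]]
  conv_lhs => rw [key]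
  rw [csum_finset_sum]
  exact Finset.sum_congr rfl fun k _ => csum_kron_right k fun _ => a k

end CompleteSemiring

/-! ### Convolution of functions on a commutative monoid -/

/-- Functions `M → R` on a commutative monoid `M`, with pointwise addition and with multiplication
by convolution. All sums converge since `R` is complete, so no support condition is needed. -/
def ConvFun (M : Type u) (R : Type v) : Type (max u v) := M → R

namespace ConvFun

section pointwise

variable {M : Type u} {R : Type v} [CommSemiring R]

noncomputable instance : AddCommMonoid (ConvFun M R) := inferInstanceAs (AddCommMonoid (M → R))

theorem add_apply (a b : ConvFun M R) (m : M) : (a + b) m = a m + b m := rfl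

theorem multiset_sum_apply (S : Multiset (ConvFun M R)) (m : M) :
    S.sum m = (S.map fun a => a m).sum := by
  induction S using Multiset.induction_on with
  | empty => rfl
  | cons a S ih => simp only [Multiset.sum_cons, Multiset.map_cons, add_apply, ih]

variable [AddCommMonoid M]

noncomputable instance : One (ConvFun M R) where
  one := fun m => kron R m 0

theorem one_apply (m : M) : (1 : ConvFun M R) m = kron R m 0 := rfl

end pointwise

variable {M : Type u} [AddCommMonoid M] {R : Type v} [CommSemiring R] [CompleteSemiring.{u} R]

noncomputable instance : Mul (ConvFun M R) where
  mul a b := fun m => csum fun p => csum fun q => kron R m (p + q) * (a p * b q)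

theorem mul_apply (a b : ConvFun M R) (m : M) :
    (a * b) m = csum fun p => csum fun q => kron R m (p + q) * (a p * b q) := rfl

/-- Convolution is characterized by its pairing with arbitrary functions of the sum. -/
theorem csum_mul_apply (a b : ConvFun M R) (F : M → R) :
    (csum fun m => F m * (a * b) m) = csum fun p => csum fun q => F (p + q) * (a p * b q) := by
  simp only [mul_apply, mul_csum]
  rw [csum_comm]
  congr 1
  funext p
  rw [csum_comm]
  congr 1
  funext q
  simp only [mul_left_comm (F _) (kron R _ _)]
  exact csum_kron_right (p + q) fun m => F m * (a p * b q)

protected theorem mul_comm (a b : ConvFun M R) : a * b = b * a := by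
  funext m
  rw [mul_apply, mul_apply, csum_comm]
  simp only [add_comm, mul_comm]

protected theorem one_mul (a : ConvFun M R) : 1 * a = a := by
  funext m
  rw [mul_apply, csum_comm]
  simp only [one_apply, mul_left_comm (kron R m _), csum_kron_right, zero_add]
  exact csum_kron_left m a

protected theorem mul_assoc (a b c : ConvFun M R) : a * b * c = a * (b * c) := by
  funext m
  rw [mul_apply, mul_apply, csum_comm]
  have hl : ∀ r, (csum fun p => kron R m (p + r) * ((a * b) p * c r)) =
      csum fun p => csum fun q => kron R m (p + q + r) * (a p * b q * c r) := fun r => by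
    simp only [← mul_assoc, mul_right_comm _ _ (c r)]
    simpa only [← mul_assoc] using csum_mul_apply a b fun n => kron R m (n + r) * c r
  have hr : ∀ p, (csum fun n => kron R m (p + n) * (a p * (b * c) n)) =
      csum fun q => csum fun r => kron R m (p + q + r) * (a p * b q * c r) := fun p => by
    simp only [← mul_assoc]
    simpa only [← mul_assoc, ← add_assoc] using csum_mul_apply b c fun n => kron R m (p + n) * a p
  simp only [hl, hr]
  rw [csum_comm]
  congr 1
  funext p
  exact csum_comm _

protected theorem mul_add (a b c : ConvFun M R) : a * (b + c) = a * b + a * c := by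
  funext m
  simp only [mul_apply, add_apply, mul_add, csum_add]

protected theorem mul_zero (a : ConvFun M R) : a * 0 = 0 := by
  funext m
  have : ∀ q, (0 : ConvFun M R) q = 0 := fun _ => rfl
  simp only [mul_apply, this, mul_zero, csum_zero]

noncomputable instance : CommSemiring (ConvFun M R) where
  __ := (inferInstance : AddCommMonoid (ConvFun M R))
  mul_comm := ConvFun.mul_comm
  one_mul := ConvFun.one_mul
  mul_one a := (ConvFun.mul_comm a 1).trans (ConvFun.one_mul a)
  mul_assoc := ConvFun.mul_assoc
  left_distrib := ConvFun.mul_add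
  right_distrib a b c := by simp only [ConvFun.mul_comm _ c, ConvFun.mul_add]
  zero_mul a := (ConvFun.mul_comm 0 a).trans (ConvFun.mul_zero a)
  mul_zero := ConvFun.mul_zero
  npow := npowRec

/-- The function concentrated at `0` with value `r`. -/
noncomputable def const (M : Type u) [AddCommMonoid M] (r : R) : ConvFun M R :=
  fun m => kron R m 0 * r

theorem const_mul_apply (r : R) (a : ConvFun M R) (m : M) : (const M r * a) m = r * a m := by
  rw [mul_apply, csum_comm]
  simp only [const, mul_assoc, mul_left_comm (kron R m _), csum_kron_right, zero_add]
  rw [← mul_csum]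
  exact congrArg (r * ·) (csum_kron_left m a)

end ConvFun

/-! ### Transposed graphs -/

namespace RPi

variable {R : Type v} [CommSemiring R] [CompleteSemiring.{u} R]

/-- The transpose of the matrix of a function `h : Y → X`, as a map `X ⟶ Y`. -/
noncomputable def cograph {X Y : RPi.{u} R} (h : Y.carrier → X.carrier) : X ⟶ Y :=
  Hom.mk fun x y => kron R x (h y)

theorem cograph_mat {X Y : RPi.{u} R} (h : Y.carrier → X.carrier) (x y) :
    Hom.mat (cograph h : X ⟶ Y) x y = kron R x (h y) := rfl

theorem comp_cograph_mat {X Y Z : RPi.{u} R} (f : X ⟶ Y) (h : Z.carrier → Y.carrier) (x z) :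
    Hom.mat (f ≫ cograph h) x z = Hom.mat f x (h z) := by
  simp only [comp_mat, cograph_mat, mul_comm (Hom.mat f x _)]
  exact csum_kron_right (h z) _

theorem cograph_comp_cograph {X Y Z : RPi.{u} R} (h : Y.carrier → X.carrier)
    (k : Z.carrier → Y.carrier) :
    (cograph h : X ⟶ Y) ≫ (cograph k : Y ⟶ Z) = cograph fun z => h (k z) := by
  ext x z
  rw [comp_cograph_mat]
  rfl

theorem cograph_comp_cograph_assoc {X Y Z W : RPi.{u} R} (h : Y.carrier → X.carrier)
    (k : Z.carrier → Y.carrier) (f : Z ⟶ W) :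
    (cograph h : X ⟶ Y) ≫ (cograph k : Y ⟶ Z) ≫ f = (cograph fun z => h (k z)) ≫ f := by
  rw [← Category.assoc, cograph_comp_cograph]

theorem id_eq_cograph (X : RPi.{u} R) : 𝟙 X = cograph fun x => x := rfl

theorem graph_eq_cograph {X Y : RPi.{u} R} (e : X.carrier ≃ Y.carrier) :
    (graph e : X ⟶ Y) = cograph e.symm := by
  ext x y
  change kron R (e x) y = kron R x (e.symm y)
  rw [← kron_of_injective (R := R) e.injective x, e.apply_symm_apply]

theorem cograph_tensor_cograph {X Y X' Y' : RPi.{u} R} (h : Y.carrier → X.carrier)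
    (k : Y'.carrier → X'.carrier) :
    (cograph h : X ⟶ Y) ⊗ₘ (cograph k : X' ⟶ Y') =
      cograph (X := X ⊗ X') (Y := Y ⊗ Y') (Prod.map h k) :=
  Hom.ext (funext fun x => funext fun y => (kron_prod x (Prod.map h k y)).symm)

theorem cograph_whiskerRight {X Y Z : RPi.{u} R} (h : Y.carrier → X.carrier) :
    (cograph h : X ⟶ Y) ▷ Z = cograph (X := X ⊗ Z) (Y := Y ⊗ Z) (Prod.map h id) :=
  cograph_tensor_cograph h fun z => z

theorem whiskerLeft_cograph {X Y Z : RPi.{u} R} (h : Y.carrier → X.carrier) :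
    Z ◁ (cograph h : X ⟶ Y) = cograph (X := Z ⊗ X) (Y := Z ⊗ Y) (Prod.map id h) :=
  cograph_tensor_cograph (fun z => z) h

theorem associator_hom_eq (X Y Z : RPi.{u} R) : (α_ X Y Z).hom =
    cograph (X := (X ⊗ Y) ⊗ Z) (Y := X ⊗ (Y ⊗ Z)) fun p => ((p.1, p.2.1), p.2.2) :=
  graph_eq_cograph (X := (X ⊗ Y) ⊗ Z) (Y := X ⊗ (Y ⊗ Z)) (Equiv.prodAssoc _ _ _)

theorem associator_inv_eq (X Y Z : RPi.{u} R) : (α_ X Y Z).inv =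
    cograph (X := X ⊗ (Y ⊗ Z)) (Y := (X ⊗ Y) ⊗ Z) fun p => (p.1.1, (p.1.2, p.2)) :=
  graph_eq_cograph (X := X ⊗ (Y ⊗ Z)) (Y := (X ⊗ Y) ⊗ Z) (Equiv.prodAssoc _ _ _).symm

theorem leftUnitor_hom_eq (X : RPi.{u} R) : (λ_ X).hom =
    cograph (X := 𝟙_ (RPi R) ⊗ X) (Y := X) fun x => (PUnit.unit, x) :=
  graph_eq_cograph (X := 𝟙_ (RPi R) ⊗ X) (Y := X) (Equiv.punitProd _)

theorem leftUnitor_inv_eq (X : RPi.{u} R) : (λ_ X).inv =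
    cograph (X := X) (Y := 𝟙_ (RPi R) ⊗ X) fun p => p.2 :=
  graph_eq_cograph (X := X) (Y := 𝟙_ (RPi R) ⊗ X) (Equiv.punitProd _).symm

theorem rightUnitor_hom_eq (X : RPi.{u} R) : (ρ_ X).hom =
    cograph (X := X ⊗ 𝟙_ (RPi R)) (Y := X) fun x => (x, PUnit.unit) :=
  graph_eq_cograph (X := X ⊗ 𝟙_ (RPi R)) (Y := X) (Equiv.prodPUnit _)

theorem rightUnitor_inv_eq (X : RPi.{u} R) : (ρ_ X).inv =
    cograph (X := X) (Y := X ⊗ 𝟙_ (RPi R)) fun p => p.1 :=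
  graph_eq_cograph (X := X) (Y := X ⊗ 𝟙_ (RPi R)) (Equiv.prodPUnit _).symm

theorem braiding_hom_eq (X Y : RPi.{u} R) : (β_ X Y).hom =
    cograph (X := X ⊗ Y) (Y := Y ⊗ X) fun p => (p.2, p.1) :=
  graph_eq_cograph (X := X ⊗ Y) (Y := Y ⊗ X) (Equiv.prodComm _ _)

theorem tensorμ_eq (X X' Y Y' : RPi.{u} R) : tensorμ X X' Y Y' =
    cograph (X := (X ⊗ X') ⊗ (Y ⊗ Y')) (Y := (X ⊗ Y) ⊗ (X' ⊗ Y'))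
      fun p => ((p.1.1, p.2.1), (p.1.2, p.2.2)) := by
  simp only [tensorμ, associator_hom_eq, associator_inv_eq, braiding_hom_eq,
    cograph_whiskerRight, whiskerLeft_cograph, cograph_comp_cograph]
  rfl

/-! ### Comonoids given by commutative monoids -/

/-- The comultiplication on a commutative monoid: the transposed graph of addition. -/
noncomputable def comul (M : RPi.{u} R) [AddCommMonoid M.carrier] : M ⟶ M ⊗ M :=
  cograph (X := M) (Y := M ⊗ M) fun p => p.1 + p.2

/-- The counit on a commutative monoid: the transposed graph of the zero. -/
noncomputable def counit (M : RPi.{u} R) [AddCommMonoid M.carrier] : M ⟶ 𝟙_ (RPi R) :=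
  cograph (X := M) (Y := 𝟙_ (RPi R)) fun _ => 0

/-- The tensor product of commutative monoids is their product monoid. -/
instance (M N : RPi.{u} R) [AddCommMonoid M.carrier] [AddCommMonoid N.carrier] :
    AddCommMonoid (M ⊗ N).carrier :=
  inferInstanceAs (AddCommMonoid (M.carrier × N.carrier))

/-- A morphism of comonoids between commutative monoids. -/
structure IsComult {M N : RPi.{u} R} [AddCommMonoid M.carrier] [AddCommMonoid N.carrier]
    (P : M ⟶ N) : Prop where
  comp_comul : P ≫ comul N = comul M ≫ (P ⊗ₘ P)
  comp_counit : P ≫ counit N = counit M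

namespace IsComult

variable {M N L M' N' : RPi.{u} R} [AddCommMonoid M.carrier] [AddCommMonoid N.carrier]
  [AddCommMonoid L.carrier] [AddCommMonoid M'.carrier] [AddCommMonoid N'.carrier]

theorem comp {P : M ⟶ N} {Q : N ⟶ L} (hP : IsComult P) (hQ : IsComult Q) : IsComult (P ≫ Q) where
  comp_comul := by
    rw [Category.assoc, hQ.comp_comul, reassoc_of% hP.comp_comul, tensorHom_comp_tensorHom]
  comp_counit := by rw [Category.assoc, hQ.comp_counit, hP.comp_counit]

theorem tensor {P : M ⟶ N} {Q : M' ⟶ N'} (hP : IsComult P) (hQ : IsComult Q) :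
    IsComult (P ⊗ₘ Q) where
  comp_comul := by
    have h (A B : RPi.{u} R) [AddCommMonoid A.carrier] [AddCommMonoid B.carrier] :
        comul (A ⊗ B) = (comul A ⊗ₘ comul B) ≫ tensorμ A A B B := by
      simp only [comul, tensorμ_eq, cograph_tensor_cograph, cograph_comp_cograph]
      rfl
    rw [h, h, tensorHom_comp_tensorHom_assoc, hP.comp_comul, hQ.comp_comul, Category.assoc,
      ← tensorμ_natural, tensorHom_comp_tensorHom_assoc]
  comp_counit := by
    have h (A B : RPi.{u} R) [AddCommMonoid A.carrier] [AddCommMonoid B.carrier] :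
        counit (A ⊗ B) = (counit A ⊗ₘ counit B) ≫ (λ_ _).hom := by
      simp only [counit, leftUnitor_hom_eq, cograph_tensor_cograph, cograph_comp_cograph]
      rfl
    rw [h, h, tensorHom_comp_tensorHom_assoc, hP.comp_counit, hQ.comp_counit]

/-- The transposed graph of a homomorphism of monoids is a morphism of comonoids. -/
theorem cograph (h : N.carrier →+ M.carrier) : IsComult (cograph h : M ⟶ N) where
  comp_comul := by
    simp only [comul, cograph_tensor_cograph, cograph_comp_cograph]
    congr 1
    funext p
    exact map_add h _ _
  comp_counit := by
    simp only [counit, cograph_comp_cograph, map_zero]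

theorem mat_add {P : M ⟶ N} (hP : IsComult P) (m : M.carrier) (n n' : N.carrier) :
    Hom.mat P m (n + n') = Hom.mat (comul M ≫ (P ⊗ₘ P)) m (n, n') := by
  rw [← hP.comp_comul, comul, comp_cograph_mat]

theorem mat_zero {P : M ⟶ N} (hP : IsComult P) (m : M.carrier) :
    Hom.mat P m 0 = kron R m 0 := by
  have h := comp_cograph_mat (Z := 𝟙_ (RPi R)) P (fun _ => 0) m PUnit.unit
  rw [← h]
  exact congrArg (fun f => Hom.mat f m PUnit.unit) hP.comp_counit

end IsComult

end RPi

/-! ### The functor of finite bags as a product of convolutions -/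

namespace ConvFun

variable {M : Type u} {R : Type v} [CommSemiring R] [CompleteSemiring.{u} R]

/-- The sum of the point masses at `h i` with coefficients `c i`. -/
noncomputable def push {I : Type u} (h : I → M) (c : I → R) : ConvFun M R :=
  fun m => csum fun i => kron R m (h i) * c i

theorem csum_mul_push {I : Type u} (h : I → M) (c : I → R) (F : M → R) :
    (csum fun m => F m * push h c m) = csum fun i => F (h i) * c i := by
  simp only [push, mul_csum]
  rw [csum_comm]
  congr 1
  funext i
  simp only [mul_left_comm (F _) (kron R _ _)]
  exact csum_kron_right (h i) fun m => F m * c i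

theorem push_mul_push [AddCommMonoid M] {I J : Type u} (h : I → M) (c : I → R) (k : J → M)
    (d : J → R) (m : M) :
    (push h c * push k d) m = csum fun i => csum fun j => kron R m (h i + k j) * (c i * d j) := by
  have e : ∀ p, (csum fun q => kron R m (p + q) * (push h c p * push k d q)) =
      (csum fun j => kron R m (p + k j) * d j) * push h c p := fun p => by
    rw [← csum_mul_push k d fun q => kron R m (p + q), csum_mul]
    congr 1
    funext q
    ring
  rw [mul_apply]
  simp only [e]
  rw [csum_mul_push h c fun p => csum fun j => kron R m (p + k j) * d j]
  congr 1
  funext i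
  rw [csum_mul]
  congr 1
  funext j
  ring

end ConvFun

namespace RPi

theorem bagMatrix_of_card_ne {R : Type v} [CommSemiring R] {X Y : Type u} (f : X → Y → R)
    {s : Multiset X} {t : Multiset Y} (h : s.card ≠ t.card) : bagMatrix f s t = 0 := if_neg h

variable {R : Type v} [CommSemiring R] [CompleteSemiring.{u} R]

section bagMatrix

variable {X Y : Type u}

/-- The column of `f` at `y`, as a function on bags which is concentrated on singletons. -/
noncomputable def column (f : X → Y → R) (y : Y) : ConvFun (Multiset X) R :=
  ConvFun.push (fun x => {x}) fun x => f x y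

/-- For an ordered bag `l'`, the sum over all lists `l` of `f(l₁, l'₁) ⋯ f(lₙ, l'ₙ)`, graded by the
bag underlying `l`, factors into the columns of `f` at the entries of `l'`. -/
theorem push_zipWith_eq_prod (f : X → Y → R) (l' : List Y) :
    ConvFun.push (fun l : List X => (l : Multiset X))
        (fun l => if l.length = l'.length then (List.zipWith f l l').prod else 0) =
      (l'.map (column f)).prod := by
  induction l' with
  | nil =>
    funext s
    refine (csum_single [] _ fun l hl => ?_).trans ?_
    · simp [hl]
    · simp [ConvFun.one_apply]
  | cons y l' ih =>
    funext s
    rw [List.map_cons, List.prod_cons, ← ih, column, ConvFun.push_mul_push, ConvFun.push,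
      csum_of_injective (fun p : X × List X => p.1 :: p.2), csum_fst]
    -- Only nonempty lists `x :: l` can have the length of `y :: l'`.
    · congr 1
      funext x
      congr 1
      funext l
      simp only [Multiset.singleton_add, Multiset.cons_coe, List.length_cons, add_left_inj,
        List.zipWith_cons_cons, List.prod_cons, mul_ite, mul_zero]
    · rintro ⟨x, l⟩ ⟨x', l'⟩ h
      simpa using h
    · rintro (_ | ⟨x, l⟩) h
      · simp
      · exact absurd ⟨(x, l), rfl⟩ h

/-- The column of `!f` at a bag is the convolution product of the columns of `f` at its elements;
in particular it does not depend on the chosen ordering of the bag. -/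
theorem bagMatrix_eq_prod (f : X → Y → R) (s : Multiset X) (t : Multiset Y) :
    bagMatrix f s t = (t.map (column f)).prod s := by
  classical
  have ht : (t.map (column f)).prod = (t.toList.map (column f)).prod := by
    conv_lhs => rw [← t.coe_toList]
    rw [Multiset.map_coe, Multiset.prod_coe]
  rw [ht, ← push_zipWith_eq_prod, ConvFun.push, csum_eq_sum s.lists.toFinset]
  · unfold bagMatrix
    have hl : ∀ l ∈ s.lists.toFinset, s = (l : Multiset X) := fun l hl => by
      simpa [Multiset.mem_lists_iff] using hl
    split_ifs with h
    · refine Finset.sum_congr (by congr) fun l h' => ?_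
      have e := hl l (by convert h')
      rw [← e, kron_self, one_mul, if_pos]
      rw [Multiset.length_toList, ← h, e, Multiset.coe_card]
    · refine (Finset.sum_eq_zero fun l h' => ?_).symm
      have e := hl l h'
      rw [if_neg, mul_zero]
      rwa [Multiset.length_toList, ← Multiset.coe_card, ← e]
  · intro l hl
    rw [kron_of_ne, zero_mul]
    simpa [Multiset.mem_lists_iff] using hl

theorem bagMatrix_zero_right (f : X → Y → R) (s : Multiset X) :
    bagMatrix f s 0 = kron R s 0 := by
  rw [bagMatrix_eq_prod, Multiset.map_zero, Multiset.prod_zero, ConvFun.one_apply]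

theorem bagMatrix_singleton (f : X → Y → R) (s : Multiset X) (y : Y) :
    bagMatrix f s {y} = csum fun x => kron R s {x} * f x y := by
  rw [bagMatrix_eq_prod, Multiset.map_singleton, Multiset.prod_singleton]
  rfl

theorem bagMatrix_add (f : X → Y → R) (s : Multiset X) (t t' : Multiset Y) :
    bagMatrix f s (t + t') =
      csum fun p => csum fun q => kron R s (p + q) * (bagMatrix f p t * bagMatrix f q t') := by
  simp only [bagMatrix_eq_prod, Multiset.map_add, Multiset.prod_add]
  rfl

end bagMatrix

/-! ### The derivative of a convolution product -/

section derivative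

open scoped Classical in
/-- The derivative at `x` of a function on bags: removing `x` from a bag has as many outcomes as
the multiplicity of `x` in it. -/
noncomputable def deriv {X : Type u} (x : X) (a : ConvFun (Multiset X) R) :
    ConvFun (Multiset X) R :=
  fun s => ((s.count x + 1 : ℕ) : R) * a (x ::ₘ s)

variable {X Y : Type u}

theorem deriv_one (x : X) : deriv x (1 : ConvFun (Multiset X) R) = 0 := by
  funext s
  simp only [deriv]
  rw [ConvFun.one_apply, kron_of_ne Multiset.cons_ne_zero, mul_zero]
  rfl

open scoped Classical in
/-- One half of the product rule: splittings `x + s = p + q`, weighted by `p(x)`. Those with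
`x ∈ p` come from splittings of `s`, the others have weight zero. -/
theorem deriv_mul_apply_left (x : X) (a b : ConvFun (Multiset X) R) (s : Multiset X) :
    (deriv x a * b) s = csum fun p => csum fun q =>
      kron R (x ::ₘ s) (p + q) * ((p.count x : R) * (a p * b q)) := by
  rw [csum_of_injective (fun p => x ::ₘ p) fun p q h => Multiset.cons_inj_right x |>.1 h]
  · rw [ConvFun.mul_apply]
    congr 1
    funext p
    congr 1
    funext q
    rw [Multiset.cons_add, kron_of_injective fun p q h => Multiset.cons_inj_right x |>.1 h,
      Multiset.count_cons_self]
    simp only [deriv]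
    ring
  · intro p hp
    have : p.count x = 0 := Multiset.count_eq_zero.2 fun h =>
      hp ⟨p.erase x, Multiset.cons_erase h⟩
    simp [this, csum_zero]

theorem deriv_mul (x : X) (a b : ConvFun (Multiset X) R) :
    deriv x (a * b) = deriv x a * b + a * deriv x b := by
  classical
  funext s
  rw [ConvFun.add_apply, mul_comm a (deriv x b), deriv_mul_apply_left, deriv_mul_apply_left,
    csum_comm (J := Multiset X), ← csum_add]
  simp only [deriv]
  rw [mul_comm a b, ConvFun.mul_apply, mul_csum]
  congr 1
  funext q
  rw [← csum_add, mul_csum]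
  congr 1
  funext p
  rw [mul_left_comm, add_comm q p, ← mul_add, mul_comm (a p), ← add_mul]
  -- For `x + s = p + q` the weight `s(x) + 1` is the sum of `p(x)` and `q(x)`.
  refine kron_mul_congr fun h => ?_
  congr 1
  have := congrArg (Multiset.count x) h
  rw [Multiset.count_cons_self, Multiset.count_add] at this
  rw [← Nat.cast_add]
  congr 1

theorem deriv_column (f : X → Y → R) (x : X) (y : Y) :
    deriv x (column f y) = ConvFun.const (Multiset X) (f x y) := by
  funext s
  by_cases hs : s = 0
  · subst hs
    simp only [deriv, column, ConvFun.push, ConvFun.const, kron_self]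
    rw [csum_single x]
    · simp [kron_self]
    · intro x' hx
      rw [kron_of_ne, zero_mul]
      simpa using hx.symm
  · simp only [deriv, column, ConvFun.push, ConvFun.const]
    rw [kron_of_ne hs, zero_mul, csum_single x, kron_of_ne, zero_mul, mul_zero]
    · exact fun h => hs (by simpa using congrArg Multiset.card h)
    · intro x' _
      rw [kron_of_ne, zero_mul]
      exact fun h => hs (by simpa using congrArg Multiset.card h)

theorem deriv_prod_column (f : X → Y → R) (x : X) (t : Multiset Y) [DecidableEq Y] :
    deriv x (t.map (column f)).prod = (t.map fun y =>
      ConvFun.const (Multiset X) (f x y) * ((t.erase y).map (column f)).prod).sum := by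
  induction t using Multiset.induction_on with
  | empty => simpa using deriv_one x
  | cons y t ih =>
    rw [Multiset.map_cons, Multiset.prod_cons, deriv_mul, deriv_column, ih, Multiset.map_cons,
      Multiset.sum_cons, Multiset.erase_cons_head, ← Multiset.sum_map_mul_left]
    congr 2
    refine Multiset.map_congr rfl fun z hz => ?_
    rw [Multiset.erase_cons_tail_of_mem hz, Multiset.map_cons, Multiset.prod_cons, mul_left_comm]

open scoped Classical in
/-- The derivative of the matrix of `!f`; this is the naturality of `d`, entry by entry. -/
theorem count_mul_bagMatrix_cons (f : X → Y → R) (x : X) (s : Multiset X) (t : Multiset Y) :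
    ((s.count x + 1 : ℕ) : R) * bagMatrix f (x ::ₘ s) t =
      (t.map fun y => f x y * bagMatrix f s (t.erase y)).sum := by
  have h := congrArg (fun a : ConvFun (Multiset X) R => a s) (deriv_prod_column f x t)
  simp only [deriv, ← bagMatrix_eq_prod] at h
  rw [h, ConvFun.multiset_sum_apply, Multiset.map_map]
  simp only [Function.comp_apply, ConvFun.const_mul_apply, bagMatrix_eq_prod]

end derivative

end RPi

/-! ### The coalgebra modality -/

namespace RPi

variable {R : Type v} [CommSemiring R] [CompleteSemiring.{u} R]

/-- Bags form a commutative monoid under union with multiplicities. -/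
instance (A : RPi.{u} R) : AddCommMonoid ((bagExponential R).bang A).carrier :=
  inferInstanceAs (AddCommMonoid (Multiset A.carrier))

section structureMaps

/-- The function underlying the comultiplication of the comonad: the sum of a bag of bags. -/
def bagJoin (A : RPi.{u} R) : ((bagExponential R).bang ((bagExponential R).bang A)).carrier →
    ((bagExponential R).bang A).carrier := Multiset.join

/-- The function underlying the counit of the comonad: the bag with one given element. -/
def bagSingle (A : RPi.{u} R) : A.carrier → ((bagExponential R).bang A).carrier :=
  fun x => ({x} : Multiset A.carrier)

/-- The function underlying the monoidal structure: the bags of first and second components. -/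
def bagUnzip (A B : RPi.{u} R) : ((bagExponential R).bang (A ⊗ B)).carrier →
    ((bagExponential R).bang A ⊗ (bagExponential R).bang B).carrier :=
  fun t : Multiset (A.carrier × B.carrier) => (t.map Prod.fst, t.map Prod.snd)

/-- The function on bags induced by a function on elements. -/
def bagMap {A B : RPi.{u} R} (h : B.carrier → A.carrier) :
    ((bagExponential R).bang B).carrier → ((bagExponential R).bang A).carrier := Multiset.map h

variable (A B : RPi.{u} R)

theorem rho_eq : (bagExponential R).rho A = cograph (bagJoin A) := rfl

theorem eps_eq : (bagExponential R).eps A = cograph (bagSingle A) := rfl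

theorem Delta_eq : (bagExponential R).Delta A = cograph (X := (bagExponential R).bang A)
    (Y := (bagExponential R).bang A ⊗ (bagExponential R).bang A) fun p => p.1 + p.2 := rfl

theorem e_eq : (bagExponential R).e A = cograph (X := (bagExponential R).bang A)
    (Y := 𝟙_ (RPi R)) fun _ => 0 := rfl

theorem m_eq : (bagExponential R).m A B = cograph (bagUnzip A B) :=
  Hom.ext (funext fun p => funext fun t => (kron_prod p (bagUnzip A B t)).symm)

theorem mI_eq : (bagExponential R).mI = cograph (X := 𝟙_ (RPi R))
    (Y := (bagExponential R).bang (𝟙_ (RPi R))) fun _ => PUnit.unit :=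
  Hom.ext (funext fun _ => funext fun _ => (kron_self _).symm)

end structureMaps

theorem eps_natural {A B : RPi.{u} R} (f : A ⟶ B) :
    (bagExponential R).bangMap f ≫ (bagExponential R).eps B =
      (bagExponential R).eps A ≫ f := by
  ext s y
  rw [eps_eq, comp_cograph_mat]
  exact bagMatrix_singleton (Hom.mat f) s y

/-- The map `!f` is a morphism of comonoids: its columns are multiplicative in the bag. -/
theorem isComult_bangMap {A B : RPi.{u} R} (f : A ⟶ B) :
    IsComult ((bagExponential R).bangMap f) where
  comp_comul := by
    ext s ⟨t, t'⟩
    rw [comul, comp_cograph_mat]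
    refine (bagMatrix_add (Hom.mat f) s t t').trans ?_
    exact (csum_fst (I := Multiset A.carrier) (J := Multiset A.carrier) fun p =>
      kron R s (p.1 + p.2) *
        (bagMatrix (Hom.mat f) p.1 t * bagMatrix (Hom.mat f) p.2 t')).symm
  comp_counit := by
    ext s _
    rw [counit, comp_cograph_mat]
    exact bagMatrix_zero_right (Hom.mat f) s

/-- Bags form the cofree cocommutative comonoid, uniqueness part: a morphism of comonoids into
`!Y` is determined by its composite with the counit of the comonad. -/
theorem IsComult.ext_eps {M Y : RPi.{u} R} [AddCommMonoid M.carrier]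
    {P Q : M ⟶ (bagExponential R).bang Y} (hP : IsComult P) (hQ : IsComult Q)
    (h : P ≫ (bagExponential R).eps Y = Q ≫ (bagExponential R).eps Y) : P = Q := by
  ext m t
  induction t using Multiset.induction_on generalizing m with
  | empty => exact (hP.mat_zero m).trans (hQ.mat_zero m).symm
  | cons y t ih =>
    have e : y ::ₘ t = ({y} : Multiset Y.carrier) + t := (Multiset.singleton_add y t).symm
    have hy : ∀ m, Hom.mat P m ({y} : Multiset Y.carrier) =
        Hom.mat Q m ({y} : Multiset Y.carrier) := fun m => by
      have := congrArg (fun f => Hom.mat f m y) h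
      simp only [eps_eq, comp_cograph_mat] at this
      exact this
    rw [e]
    refine (hP.mat_add m _ t).trans (Eq.trans ?_ (hQ.mat_add m _ t).symm)
    rw [comp_mat, comp_mat]
    congr 1
    funext p
    congr 1
    exact congrArg₂ (· * ·) (hy p.1) (ih p.2)

/-- The functor `!` takes the transposed graph of `h` to the transposed graph of `map h`. -/
theorem bangMap_cograph {A B : RPi.{u} R} (h : B.carrier → A.carrier) :
    (bagExponential R).bangMap (cograph h : A ⟶ B) = cograph (bagMap h) := by
  refine (isComult_bangMap _).ext_eps (IsComult.cograph (M := (bagExponential R).bang A)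
    (N := (bagExponential R).bang B) (Multiset.mapAddMonoidHom h)) ?_
  rw [eps_natural, eps_eq, eps_eq, cograph_comp_cograph, cograph_comp_cograph]
  rfl

theorem isComult_rho (A : RPi.{u} R) : IsComult ((bagExponential R).rho A) :=
  IsComult.cograph (M := (bagExponential R).bang A)
    (N := (bagExponential R).bang ((bagExponential R).bang A))
    ⟨⟨Multiset.join, Multiset.join_zero⟩, Multiset.join_add⟩

theorem isComult_m (A B : RPi.{u} R) : IsComult ((bagExponential R).m A B) := by
  rw [m_eq]
  exact IsComult.cograph (M := (bagExponential R).bang A ⊗ (bagExponential R).bang B)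
    (N := (bagExponential R).bang (A ⊗ B))
    ((Multiset.mapAddMonoidHom Prod.fst).prod (Multiset.mapAddMonoidHom Prod.snd))

theorem rho_eps (A : RPi.{u} R) :
    (bagExponential R).rho A ≫ (bagExponential R).eps ((bagExponential R).bang A) = 𝟙 _ := by
  rw [rho_eq, eps_eq, cograph_comp_cograph, id_eq_cograph]
  congr 1
  funext s
  exact Multiset.sum_singleton (s : Multiset A.carrier)

theorem bagExponential_isCoalgebraModality : (bagExponential.{u} R).IsCoalgebraModality where
  map_id A := by
    rw [id_eq_cograph, bangMap_cograph, id_eq_cograph]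
    congr 1
    funext s
    exact Multiset.map_id s
  map_comp f g := by
    refine (isComult_bangMap _).ext_eps ((isComult_bangMap f).comp (isComult_bangMap g)) ?_
    rw [eps_natural, Category.assoc, eps_natural, reassoc_of% eps_natural f]
  rho_natural {X Y} f := by
    refine ((isComult_bangMap f).comp (isComult_rho _)).ext_eps
      ((isComult_rho _).comp (isComult_bangMap _)) ?_
    rw [Category.assoc, Category.assoc, eps_natural, rho_eps, reassoc_of% rho_eps X,
      Category.comp_id]
  eps_natural := eps_natural
  Delta_natural f := (isComult_bangMap f).comp_comul
  e_natural f := (isComult_bangMap f).comp_counit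
  rho_eps := rho_eps
  rho_map_eps A := by
    rw [eps_eq, bangMap_cograph, rho_eq, cograph_comp_cograph, id_eq_cograph]
    congr 1
    funext s
    -- The sum of the singletons of the elements of `s` is a `bind`.
    exact (Multiset.bind_singleton s fun x => x).trans (Multiset.map_id s)
  rho_rho A := by
    rw [rho_eq, rho_eq, bangMap_cograph, cograph_comp_cograph, cograph_comp_cograph]
    congr 1
    funext S
    exact Multiset.sum_join (S := (S : Multiset (Multiset (Multiset A.carrier))))
  Delta_assoc A := by
    simp only [Delta_eq, cograph_whiskerRight, whiskerLeft_cograph, associator_hom_eq,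
      cograph_comp_cograph]
    congr 1
    funext p
    exact add_assoc _ _ _
  Delta_e_left A := by
    simp only [Delta_eq, e_eq, cograph_whiskerRight, leftUnitor_inv_eq, cograph_comp_cograph]
    congr 1
    funext p
    exact zero_add _
  Delta_e_right A := by
    simp only [Delta_eq, e_eq, whiskerLeft_cograph, rightUnitor_inv_eq, cograph_comp_cograph]
    congr 1
    funext p
    exact add_zero _
  Delta_comm A := by
    simp only [Delta_eq, braiding_hom_eq, cograph_comp_cograph]
    congr 1
    funext p
    exact add_comm _ _
  rho_Delta A := (isComult_rho A).comp_comul.symm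
  rho_e A := (isComult_rho A).comp_counit

/-! ### The monoidal structure of the exponential -/

theorem bagExponential_isMonoidalModality : (bagExponential.{u} R).IsMonoidalModality where
  m_natural {A B X Y} f g := by
    have hm (A B : RPi.{u} R) : (bagExponential R).m A B ≫ (bagExponential R).eps (A ⊗ B) =
        (bagExponential R).eps A ⊗ₘ (bagExponential R).eps B := by
      rw [m_eq, eps_eq, eps_eq, eps_eq, cograph_comp_cograph, cograph_tensor_cograph]
      rfl
    refine (((isComult_bangMap f).tensor (isComult_bangMap g)).comp (isComult_m _ _)).ext_eps
      ((isComult_m _ _).comp (isComult_bangMap _)) ?_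
    rw [Category.assoc, Category.assoc, hm, eps_natural, reassoc_of% hm A X,
      tensorHom_comp_tensorHom, tensorHom_comp_tensorHom, eps_natural, eps_natural]
  m_assoc X Y Z := by
    simp only [m_eq, associator_hom_eq, bangMap_cograph, cograph_whiskerRight,
      whiskerLeft_cograph, cograph_comp_cograph]
    congr 1
    funext p
    have h (t : Multiset (X.carrier × (Y.carrier × Z.carrier))) :
        (((t.map fun p => ((p.1, p.2.1), p.2.2)).map Prod.fst).map Prod.fst,
          ((t.map fun p => ((p.1, p.2.1), p.2.2)).map Prod.fst).map Prod.snd,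
          (t.map fun p => ((p.1, p.2.1), p.2.2)).map Prod.snd) =
        (t.map Prod.fst, (t.map Prod.snd).map Prod.fst, (t.map Prod.snd).map Prod.snd) := by
      simp only [Multiset.map_map, Function.comp_def]
    exact congrArg (fun x => ((x.1, x.2.1), x.2.2)) (h p)
  m_unit_left A := by
    simp only [m_eq, mI_eq, leftUnitor_hom_eq, bangMap_cograph, cograph_whiskerRight,
      cograph_comp_cograph]
    congr 1
    funext p
    have h (t : Multiset A.carrier) :
        (t.map fun x => (PUnit.unit.{u + 1}, x)).map Prod.snd = t := by
      simp only [Multiset.map_map, Function.comp_def, Multiset.map_id']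
    exact congrArg (fun x => (PUnit.unit, x)) (h p)
  m_unit_right A := by
    simp only [m_eq, mI_eq, rightUnitor_hom_eq, bangMap_cograph, whiskerLeft_cograph,
      cograph_comp_cograph]
    congr 1
    funext p
    have h (t : Multiset A.carrier) :
        (t.map fun x => (x, PUnit.unit.{u + 1})).map Prod.fst = t := by
      simp only [Multiset.map_map, Function.comp_def, Multiset.map_id']
    exact congrArg (fun x => (x, PUnit.unit)) (h p)
  m_symm A B := by
    simp only [m_eq, braiding_hom_eq, bangMap_cograph, cograph_comp_cograph]
    congr 1
    funext p
    have h (t : Multiset (B.carrier × A.carrier)) :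
        (t.map Prod.snd, t.map Prod.fst) = ((t.map fun p => (p.2, p.1)).map Prod.fst,
          (t.map fun p => (p.2, p.1)).map Prod.snd) := by
      simp only [Multiset.map_map, Function.comp_def]
    exact h p
  m_rho A B := by
    simp only [m_eq, rho_eq, bangMap_cograph, cograph_tensor_cograph, cograph_comp_cograph]
    congr 1
    funext p
    have h (T : Multiset (Multiset (A.carrier × B.carrier))) :
        (T.join.map Prod.fst, T.join.map Prod.snd) =
        (((T.map fun t => (t.map Prod.fst, t.map Prod.snd)).map Prod.fst).join,
          ((T.map fun t => (t.map Prod.fst, t.map Prod.snd)).map Prod.snd).join) := by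
      simp only [Multiset.map_map, Function.comp_def, Multiset.map_join]
    exact h p
  m_eps A B := by
    simp only [m_eq, eps_eq, cograph_tensor_cograph, cograph_comp_cograph]
    rfl
  mI_rho := by
    simp only [mI_eq, rho_eq, bangMap_cograph, cograph_comp_cograph]
  mI_eps := by
    simp only [mI_eq, eps_eq, cograph_comp_cograph]
    rfl
  m_Delta A B := by
    simp only [m_eq, Delta_eq, tensorμ_eq, cograph_tensor_cograph, cograph_comp_cograph]
    congr 1
    funext p
    exact Prod.ext (Multiset.map_add _ _ _) (Multiset.map_add _ _ _)
  m_e A B := by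
    simp only [m_eq, e_eq, leftUnitor_hom_eq, cograph_tensor_cograph, cograph_comp_cograph]
    rfl
  mI_Delta := by
    simp only [mI_eq, Delta_eq, leftUnitor_inv_eq, cograph_tensor_cograph, cograph_comp_cograph]
    rfl
  mI_e := by
    simp only [mI_eq, e_eq, cograph_comp_cograph]
    rfl
  rho_map_Delta A := by
    simp only [rho_eq, Delta_eq, m_eq, bangMap_cograph, cograph_tensor_cograph,
      cograph_comp_cograph]
    congr 1
    funext p
    have h (T : Multiset (Multiset A.carrier × Multiset A.carrier)) :
        (T.map fun p => p.1 + p.2).join = (T.map Prod.fst).join + (T.map Prod.snd).join :=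
      Multiset.sum_map_add
    exact h p
  rho_map_e A := by
    simp only [rho_eq, e_eq, mI_eq, bangMap_cograph, cograph_comp_cograph]
    congr 1
    funext p
    have h (t : Multiset PUnit.{u + 1}) :
        (t.map fun _ => (0 : Multiset A.carrier)).join = 0 :=
      Multiset.sum_map_zero
    exact h p

end RPi

/-! ### The deriving transformation -/

namespace RPi

open scoped Classical in
/-- The number of ways to remove `x` from the summand `t` of `w + t` is its multiplicity in `t`. -/
theorem sum_kron_erase {R : Type v} [CommSemiring R] {X : Type u} (s w t : Multiset X) (x : X) :
    (t.map fun y => kron R (s, x) (w + t.erase y, y)).sum =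
      (t.count x : R) * kron R (x ::ₘ s) (w + t) := by
  rw [Finset.sum_multiset_map_count, Finset.sum_eq_single x]
  · by_cases hx : x ∈ t
    · rw [nsmul_eq_mul, kron_prod, kron_self, mul_one,
        ← kron_of_injective (h := fun p : Multiset X => x ::ₘ p)
          (fun p q h => (Multiset.cons_inj_right x).1 h),
        ← Multiset.add_cons, Multiset.cons_erase hx]
    · simp [Multiset.count_eq_zero.2 hx]
  · intro y _ hy
    rw [kron_of_ne fun h => hy (congrArg Prod.snd h).symm, smul_zero]
  · intro hx
    simp [Multiset.count_eq_zero.2 fun h => hx (Multiset.mem_toFinset.2 h)]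

variable {R : Type v} [CommSemiring R] [CompleteSemiring.{u} R]

theorem whiskerRight_comp_mat {X Y Z W : RPi.{u} R} (f : X ⟶ Y) (g : Y ⊗ Z ⟶ W)
    (x : X.carrier) (z : Z.carrier) (w : W.carrier) :
    Hom.mat (f ▷ Z ≫ g) (x, z) w = csum fun y => Hom.mat f x y * Hom.mat g (y, z) w := by
  rw [comp_mat]
  refine (csum_fst (I := Y.carrier) (J := Z.carrier) _).trans ?_
  congr 1
  funext y
  change (csum fun z' => Hom.mat f x y * kron R z z' * Hom.mat g (y, z') w) = _
  simp only [mul_assoc, mul_left_comm (Hom.mat f x y)]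
  exact csum_kron_left z fun z' => Hom.mat f x y * Hom.mat g (y, z') w

theorem comp_whiskerRight_mat {X Y Z W : RPi.{u} R} (f : W ⟶ X ⊗ Z) (g : X ⟶ Y)
    (w : W.carrier) (y : Y.carrier) (z : Z.carrier) :
    Hom.mat (f ≫ g ▷ Z) w (y, z) = csum fun x => Hom.mat f w (x, z) * Hom.mat g x y := by
  rw [comp_mat]
  refine (csum_fst (I := X.carrier) (J := Z.carrier) _).trans ?_
  congr 1
  funext x
  change (csum fun z' => Hom.mat f w (x, z') * (Hom.mat g x y * kron R z' z)) = _
  simp only [mul_comm _ (kron R _ z), mul_left_comm _ (kron R _ z)]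
  exact csum_kron_right z fun z' => Hom.mat f w (x, z') * Hom.mat g x y

theorem comp_whiskerLeft_mat {X Y Z W : RPi.{u} R} (f : W ⟶ Z ⊗ X) (g : X ⟶ Y)
    (w : W.carrier) (z : Z.carrier) (y : Y.carrier) :
    Hom.mat (f ≫ Z ◁ g) w (z, y) = csum fun x => Hom.mat f w (z, x) * Hom.mat g x y := by
  rw [comp_mat]
  refine (csum_fst (I := Z.carrier) (J := X.carrier) _).trans ((csum_comm _).trans ?_)
  congr 1
  funext x
  change (csum fun z' => Hom.mat f w (z', x) * (kron R z' z * Hom.mat g x y)) = _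
  simp only [mul_left_comm _ (kron R _ z)]
  exact csum_kron_right z fun z' => Hom.mat f w (z', x) * Hom.mat g x y

section derivingTransformation

open scoped Classical

/-- On the support of `d` the multiplicity `t(x)` is `s(x) + 1`, since `t = s + x` there. -/
theorem d_mat (A : RPi.{u} R) (s : Multiset A.carrier) (x : A.carrier) (t : Multiset A.carrier) :
    Hom.mat ((bagExponential R).d A) (s, x) t = ((s.count x + 1 : ℕ) : R) * kron R (x ::ₘ s) t := by
  change (t.count x : R) * kron R (x ::ₘ s) t = _
  rw [mul_comm, mul_comm _ (kron R _ _)]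
  refine kron_mul_congr fun h => ?_
  rw [← h, Multiset.count_cons_self]

theorem csum_d_mul (A : RPi.{u} R) (s : Multiset A.carrier) (x : A.carrier)
    (F : Multiset A.carrier → R) :
    (csum fun t => Hom.mat ((bagExponential R).d A) (s, x) t * F t) =
      ((s.count x + 1 : ℕ) : R) * F (x ::ₘ s) := by
  refine (congrArg csum (funext fun t => ?_)).trans ((mul_csum _ _).symm.trans
    (congrArg _ (csum_kron_left (x ::ₘ s) F)))
  exact (congrArg (· * F t) (d_mat A s x t)).trans (mul_assoc _ _ _)

/-- Summing against `d` on the left runs over the elements of `t`, with multiplicity, each being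
removed from `t`. -/
theorem csum_mul_d (A : RPi.{u} R) (t : Multiset A.carrier)
    (F : Multiset A.carrier × A.carrier → R) :
    (csum fun p => F p * Hom.mat ((bagExponential R).d A) p t) =
      (t.map fun y => F (t.erase y, y)).sum := by
  change (csum fun p => F p * ((t.count p.2 : R) * kron R (p.2 ::ₘ p.1) t)) = _
  rw [csum_eq_sum (t.toFinset.image fun y => (t.erase y, y)), Finset.sum_image,
    Finset.sum_multiset_map_count]
  · refine Finset.sum_congr rfl fun y hy => ?_
    rw [Multiset.cons_erase (Multiset.mem_toFinset.1 hy), kron_self, mul_one, mul_comm,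
      nsmul_eq_mul]
  · intro y _ y' _ h
    exact congrArg Prod.snd h
  -- A pair `(s, y)` with `s + y = t` is the pair obtained by removing `y` from `t`.
  · rintro ⟨s, y⟩ h
    rw [kron_of_ne, mul_zero, mul_zero]
    rintro rfl
    exact h (Finset.mem_image.2 ⟨y, by simp, by simp⟩)

theorem d_comp_mat {A Z : RPi.{u} R} (g : (bagExponential R).bang A ⟶ Z)
    (s : Multiset A.carrier) (x : A.carrier) (z : Z.carrier) :
    Hom.mat ((bagExponential R).d A ≫ g) (s, x) z =
      ((s.count x + 1 : ℕ) : R) * Hom.mat g (x ::ₘ s) z :=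
  csum_d_mul A s x fun t => Hom.mat g t z

theorem comp_d_mat {A Z : RPi.{u} R} (g : Z ⟶ (bagExponential R).bang A ⊗ A)
    (z : Z.carrier) (t : Multiset A.carrier) :
    Hom.mat (g ≫ (bagExponential R).d A) z t =
      (t.map fun y => Hom.mat g z (t.erase y, y)).sum :=
  csum_mul_d A t fun p => Hom.mat g z p

theorem d_mat_comp_d_mat (A : RPi.{u} R) (s : Multiset A.carrier) (x y : A.carrier)
    (t : Multiset A.carrier) :
    Hom.mat ((bagExponential R).d A ▷ A ≫ (bagExponential R).d A) ((s, x), y) t =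
      (((s.count x + 1) * ((x ::ₘ s).count y + 1) : ℕ) : R) * kron R (y ::ₘ x ::ₘ s) t := by
  refine (whiskerRight_comp_mat _ _ _ _ _).trans ((csum_d_mul A s x _).trans ?_)
  refine (congrArg _ (d_mat A (x ::ₘ s) y t)).trans ?_
  rw [Nat.cast_mul, mul_assoc]

theorem comp_d_whiskerRight_mat {A Y Z : RPi.{u} R} (g : Z ⟶ ((bagExponential R).bang A ⊗ A) ⊗ Y)
    (z : Z.carrier) (t : Multiset A.carrier) (y : Y.carrier) :
    Hom.mat (g ≫ (bagExponential R).d A ▷ Y) z (t, y) =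
      (t.map fun x => Hom.mat g z ((t.erase x, x), y)).sum :=
  (comp_whiskerRight_mat _ _ _ _ _).trans (csum_mul_d A t fun p => Hom.mat g z (p, y))

theorem comp_whiskerLeft_d_mat {A Y Z : RPi.{u} R} (g : Z ⟶ Y ⊗ ((bagExponential R).bang A ⊗ A))
    (z : Z.carrier) (y : Y.carrier) (t : Multiset A.carrier) :
    Hom.mat (g ≫ Y ◁ (bagExponential R).d A) z (y, t) =
      (t.map fun x => Hom.mat g z (y, (t.erase x, x))).sum :=
  (comp_whiskerLeft_mat _ _ _ _ _).trans (csum_mul_d A t fun p => Hom.mat g z (y, p))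

/-- Removing `x` from `t + t'` means removing it from `t` (first summand) or from `t'` (second
summand). -/
theorem leibniz_rule (A : RPi.{u} R) :
    (bagExponential R).d A ≫ (bagExponential R).Delta A =
      ((bagExponential R).Delta A ▷ A) ≫ (α_ _ _ A).hom ≫
          ((bagExponential R).bang A ◁ (β_ ((bagExponential R).bang A) A).hom) ≫
          (α_ ((bagExponential R).bang A) A ((bagExponential R).bang A)).inv ≫
          ((bagExponential R).d A ▷ (bagExponential R).bang A) +
        ((bagExponential R).Delta A ▷ A) ≫ (α_ _ _ A).hom ≫
          ((bagExponential R).bang A ◁ (bagExponential R).d A) := by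
  apply hom_ext
  rintro ⟨(s : Multiset A.carrier), x⟩ ⟨(t : Multiset A.carrier), (t' : Multiset A.carrier)⟩
  simp only [Delta_eq, cograph_whiskerRight, whiskerLeft_cograph, associator_hom_eq,
    associator_inv_eq, braiding_hom_eq, ← Category.assoc, cograph_comp_cograph]
  refine (d_comp_mat _ s x (t, t')).trans (Eq.trans ?_ (congrArg₂ (· + ·)
    ((comp_d_whiskerRight_mat _ _ t t').trans
      ((congrArg Multiset.sum (Multiset.map_congr rfl fun y _ => ?_)).trans
        (sum_kron_erase (R := R) s t' t x)))
    ((comp_whiskerLeft_d_mat _ _ t t').trans (sum_kron_erase (R := R) s t t' x))).symm)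
  · change _ * kron R (x ::ₘ s) (t + t') = _
    rw [add_comm t' t, ← add_mul, mul_comm, mul_comm (_ + _)]
    refine kron_mul_congr fun h => ?_
    rw [← Nat.cast_add, ← Multiset.count_add, ← h, Multiset.count_cons_self]
  · exact congrArg (fun w => kron R (s, x) (w, y)) (add_comm _ _)

/-- Removing `x` from the sum of a bag of bags `T` means choosing a member `u` of `T` and removing
`x` from `u`; the multiplicities `u(x)` add up to that of `x` in the sum. -/
theorem chain_rule (A : RPi.{u} R) :
    (bagExponential R).d A ≫ (bagExponential R).rho A =
      ((bagExponential R).Delta A ▷ A) ≫ (α_ _ _ A).hom ≫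
        ((bagExponential R).rho A ⊗ₘ (bagExponential R).d A) ≫
        (bagExponential R).d ((bagExponential R).bang A) := by
  apply hom_ext
  rintro ⟨(s : Multiset A.carrier), x⟩ (T : Multiset (Multiset A.carrier))
  rw [MonoidalCategory.tensorHom_def]
  simp only [Delta_eq, rho_eq, cograph_whiskerRight, associator_hom_eq, ← Category.assoc,
    cograph_comp_cograph]
  refine (d_comp_mat _ s x T).trans (Eq.trans ?_ ((comp_d_mat _ _ T).trans
    (congrArg Multiset.sum (Multiset.map_congr rfl fun u _ =>
      (comp_whiskerLeft_d_mat _ _ _ u).trans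
        (sum_kron_erase (R := R) s (Multiset.join (@Multiset.erase _ (_) T u)) u x)))).symm)
  change _ * kron R (x ::ₘ s) (Multiset.join T) = _
  have hT (_ : DecidableEq (Multiset A.carrier)) : ∀ u ∈ T,
      (u.count x : R) * kron R (x ::ₘ s) (Multiset.join (Multiset.erase T u) + u) =
        (u.count x : R) * kron R (x ::ₘ s) (Multiset.join T) := fun u hu => by
    rw [add_comm, ← Multiset.join_cons, Multiset.cons_erase hu]
  refine Eq.trans ?_ (congrArg Multiset.sum (Multiset.map_congr rfl (hT _))).symm
  rw [Multiset.sum_map_mul_right, mul_comm, mul_comm _ (kron R _ _)]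
  refine kron_mul_congr fun h => ?_
  have e : s.count x + 1 = (T.map fun u => u.count x).sum := by
    rw [← Multiset.count_cons_self, h]
    exact map_multiset_sum (Multiset.countAddMonoidHom x) T
  rw [e, Nat.cast_multiset_sum, Multiset.map_map]
  rfl

theorem bagExponential_isDeriving : (bagExponential.{u} R).IsDeriving where
  d_natural {X Y} f := by
    ext ⟨s, x⟩ t
    refine (comp_d_mat _ _ t).trans (Eq.trans ?_ ((d_comp_mat _ s x t).trans
      (count_mul_bagMatrix_cons (Hom.mat f) x s t)).symm)
    exact congrArg Multiset.sum (Multiset.map_congr rfl fun y _ => mul_comm _ _)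
  constant_rule A := by
    ext ⟨s, x⟩ _
    exact (d_comp_mat _ s x _).trans ((congrArg _ (kron_of_ne Multiset.cons_ne_zero)).trans
      (mul_zero _))
  leibniz_rule := leibniz_rule
  linear_rule A := by
    apply hom_ext
    rintro ⟨(s : Multiset A.carrier), x⟩ a
    simp only [e_eq, cograph_whiskerRight, leftUnitor_hom_eq, cograph_comp_cograph]
    refine (d_comp_mat _ s x a).trans ?_
    change _ * kron R (x ::ₘ s) {a} = kron R (s, x) ((0 : Multiset A.carrier), a)
    rw [kron_prod]
    by_cases hs : s = (0 : Multiset A.carrier)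
    · subst hs
      rw [kron_self, ← kron_of_injective (h := fun x : A.carrier => ({x} : Multiset A.carrier))
        fun _ _ h => Multiset.singleton_inj.1 h]
      simp
    · rw [kron_of_ne hs, kron_of_ne, mul_zero, zero_mul]
      exact fun h => hs (by simpa using congrArg Multiset.card h)
  chain_rule := chain_rule
  interchange_rule A := by
    simp only [associator_hom_eq, associator_inv_eq, braiding_hom_eq, whiskerLeft_cograph,
      cograph_comp_cograph_assoc]
    apply hom_ext
    rintro ⟨⟨(s : Multiset A.carrier), x⟩, y⟩ (t : Multiset A.carrier)
    -- The exchange of the two arguments, as a function on the underlying set.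
    let σ : (Multiset A.carrier × A.carrier) × A.carrier →
        (Multiset A.carrier × A.carrier) × A.carrier := fun p => ((p.1.1, p.2), p.1.2)
    have hσ : Function.Injective σ := fun p q h => congrArg σ h
    refine (d_mat_comp_d_mat A s x y t).trans (Eq.trans ?_ ((congrArg csum (funext fun p =>
      congrArg (· * _) (kron_of_injective (R := R) hσ ((s, y), x) p))).trans
        ((csum_kron_left ((s, y), x) _).trans (d_mat_comp_d_mat A s y x t))).symm)
    rw [Multiset.cons_swap]
    congr 2
    by_cases e : x = y
    · rw [e]
    · rw [Multiset.count_cons_of_ne e, Multiset.count_cons_of_ne (Ne.symm e), mul_comm]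

end derivingTransformation

/-! ### Antiderivatives -/

/-- The diagonal matrix with the given entries. -/
noncomputable def diag {X : RPi.{u} R} (c : X.carrier → R) : X ⟶ X :=
  Hom.mk fun x y => kron R x y * c y

theorem comp_diag_mat {X Y : RPi.{u} R} (f : X ⟶ Y) (c : Y.carrier → R) (x y) :
    Hom.mat (f ≫ diag c) x y = Hom.mat f x y * c y := by
  rw [comp_mat]
  change (csum fun y' => Hom.mat f x y' * (kron R y' y * c y)) = _
  simp only [mul_left_comm _ (kron R _ y)]
  exact csum_kron_right y fun y' => Hom.mat f x y' * c y

theorem diag_comp_mat {X Y : RPi.{u} R} (c : X.carrier → R) (f : X ⟶ Y) (x y) :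
    Hom.mat (diag c ≫ f) x y = c x * Hom.mat f x y := by
  rw [comp_mat]
  change (csum fun x' => kron R x x' * c x' * Hom.mat f x' y) = _
  simp only [mul_assoc]
  exact csum_kron_left x fun x' => c x' * Hom.mat f x' y

theorem isIso_diag {X : RPi.{u} R} (c : X.carrier → R) (hc : ∀ x, IsUnit (c x)) :
    IsIso (diag c) := by
  choose b hb using fun x => (hc x).exists_right_inv
  refine ⟨diag b, ?_, ?_⟩
  · ext x y
    rw [comp_diag_mat]
    change kron R x y * c y * b y = kron R x y
    rw [mul_assoc, hb, mul_one]
  · ext x y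
    rw [comp_diag_mat]
    change kron R x y * b y * c y = kron R x y
    rw [mul_assoc, mul_comm (b y), hb, mul_one]

theorem bagMatrix_zero_left {X Y : Type u} (s : Multiset X) (t : Multiset Y) (ht : t ≠ 0) :
    bagMatrix (fun (_ : X) (_ : Y) => (0 : R)) s t = 0 := by
  obtain ⟨y, hy⟩ := Multiset.exists_mem_of_ne_zero ht
  have hc : column (fun (_ : X) (_ : Y) => (0 : R)) y = 0 := by
    funext s
    exact (congrArg csum (funext fun x => mul_zero _)).trans csum_zero
  rw [bagMatrix_eq_prod, Multiset.prod_eq_zero (Multiset.mem_map.2 ⟨y, hy, hc⟩)]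
  rfl

theorem coderiving_comp_d_mat (A : RPi.{u} R) (s t : Multiset A.carrier) :
    Hom.mat ((bagExponential R).coderiving A ≫ (bagExponential R).d A) s t =
      kron R s t * (t.card : R) := by
  classical
  rw [ExponentialData.coderiving, Delta_eq, eps_eq, whiskerLeft_cograph, cograph_comp_cograph]
  have h : ∀ y ∈ t, kron R s (t.erase y + {y}) = kron R s t := fun y hy => by
    rw [add_comm, Multiset.singleton_add, Multiset.cons_erase hy]
  refine (comp_d_mat _ s t).trans
    ((congrArg Multiset.sum (Multiset.map_congr rfl h)).trans ?_)
  rw [Multiset.map_const', Multiset.sum_replicate, nsmul_eq_mul, mul_comm]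

/-- On bags of size `n` the transformation `K` is multiplication by `n`, or by `1` if `n = 0`. -/
theorem K_eq_diag (A : RPi.{u} R) : (bagExponential R).K A =
    diag (X := (bagExponential R).bang A) fun t : Multiset A.carrier =>
      ((if t.card = 0 then 1 else t.card : ℕ) : R) := by
  apply hom_ext
  intro (s : Multiset A.carrier) (t : Multiset A.carrier)
  refine (congrArg (· + _) (coderiving_comp_d_mat A s t)).trans ?_
  change kron R s t * (t.card : R) + bagMatrix (fun _ _ => 0) s t =
    kron R s t * ((if t.card = 0 then 1 else t.card : ℕ) : R)
  by_cases ht : t = 0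
  · rw [ht, bagMatrix_zero_right]
    simp
  · rw [bagMatrix_zero_left s t ht, add_zero, if_neg (mt Multiset.card_eq_zero.1 ht)]

theorem bagExponential_hasAntiderivatives (hR : ∀ n : ℕ, 0 < n → IsUnit (n : R)) :
    (bagExponential.{u} R).HasAntiderivatives where
  K_natural f := by
    rw [K_eq_diag, K_eq_diag]
    apply hom_ext
    intro (s : Multiset _) (t : Multiset _)
    refine (comp_diag_mat _ _ s t).trans (Eq.trans ?_ (diag_comp_mat _ _ s t).symm)
    change bagMatrix (Hom.mat f) s t * _ = _ * bagMatrix (Hom.mat f) s t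
    -- The entries of `K` depend on the size only, and `!f` preserves it.
    by_cases h : s.card = t.card
    · rw [h, mul_comm]
    · rw [bagMatrix_of_card_ne _ h, mul_zero, zero_mul]
  K_isIso A := by
    rw [K_eq_diag]
    refine isIso_diag _ fun t => hR _ ?_
    split_ifs with h
    · exact one_pos
    · exact Nat.pos_of_ne_zero h

end RPi

/-! ### The relational model -/

namespace BoolSemiring

theorem natCast_eq_one (n : ℕ) (hn : 0 < n) : (n : BoolSemiring) = 1 := by
  induction n, hn using Nat.le_induction with
  | base => exact Nat.cast_one
  | succ n _ ih => rw [Nat.cast_succ, ih]; rfl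

theorem toRel_faithful : toRel.{u}.Faithful where
  map_injective {X Y f g} h := by
    ext x y
    have := congrArg (fun r => (x, y) ∈ RelCat.Hom.rel r) h
    exact eq_iff.2 (iff_of_eq this)

theorem toRel_full : toRel.{u}.Full where
  map_surjective {X Y} r := by
    classical
    refine ⟨RPi.Hom.mk fun x y => if (x, y) ∈ r.rel then 1 else 0, ?_⟩
    apply RelCat.Hom.ext
    ext ⟨x, y⟩
    change (if (x, y) ∈ r.rel then (1 : BoolSemiring) else 0) = 1 ↔ (x, y) ∈ r.rel
    by_cases h : (x, y) ∈ r.rel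
    · simp [h]
    · simp [h, one_ne_zero'.symm]

theorem toRel_obj_bijective : Function.Bijective toRel.{u}.obj :=
  ⟨fun ⟨_⟩ ⟨_⟩ h => congrArg RPi.mk h, fun X => ⟨⟨X⟩, rfl⟩⟩

theorem toRel_isEquivalence : toRel.{u}.IsEquivalence where
  faithful := toRel_faithful
  full := toRel_full
  essSurj := ⟨fun X => ⟨⟨X⟩, ⟨Iso.refl _⟩⟩⟩

end BoolSemiring

theorem mainTheorem6 :
    (∀ (R : Type v) [CommSemiring R] [CompleteSemiring.{u} R],
      (∀ n : ℕ, 0 < n → IsUnit (n : R)) →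
        (RPi.bagExponential.{u} R).IsDifferentialLinear ∧
          (RPi.bagExponential.{u} R).HasAntiderivatives) ∧
    ((∀ n : ℕ, 0 < n → IsUnit (n : BoolSemiring)) ∧
      BoolSemiring.toRel.{u}.IsEquivalence ∧
      Function.Bijective BoolSemiring.toRel.{u}.obj) := by
  refine ⟨fun R _ _ hR => ⟨⟨RPi.bagExponential_isCoalgebraModality,
    RPi.bagExponential_isMonoidalModality, RPi.bagExponential_isDeriving⟩,
    RPi.bagExponential_hasAntiderivatives hR⟩, fun n hn => ?_,
    BoolSemiring.toRel_isEquivalence, BoolSemiring.toRel_obj_bijective⟩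
  rw [BoolSemiring.natCast_eq_one n hn]
  exact isUnit_one
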